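/- Let $0<p<1$ and $\theta\ge 0$. For functions on $\mathbb{R}$ with real or complex values, let $\|f\|_p=\big(\int_{\mathbb R}|f|^p\,dx\big)^{1/p}$ be the quasinorm of $L^p=L^p(\mathbb{R})$. Let $\mathcal{M}=\{M_n\}_{n\ge0}$ be a sequence of positive real numbers such that $n\mapsto\log M_n$ is convex. Assume that $$\kappa(p,\mathcal{M}):=\limsup_{n\to\infty}\sum_{j=1}^n(1-p)^j\log M_j=+\infty$$ and that $\mathcal{M}$ is $p$-regular, i.e. at least one of the following holds: (i) $\liminf_{n\to\infty}(1-p)^n\log M_n>0$; (ii) $\log M_n=o\big((1-p)^{-n}\big)$ as $n\to\infty$, and there is $\delta<1$ such that $n\log n\le(\delta+o(1))\log M_n$ as $n\to\infty$. For $f\in C^\infty(\mathbb{R})$ put $\|f\|_{p,\mathcal{M}}=\sup_{k\ge0}\|f^{(k)}\|_p/M_k$, and let $\mathscr{S}^{\circledast}_{p,\theta,\mathcal{M}}$ be the space of all $f\in C^\infty(\mathbb{R})$ with $\|f\|_{p,\mathcal{M}}<\infty$ and $\limsup_{n\to\infty}(1-p)^n\log\|f^{(n)}\|_\infty\le\theta$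 (where $\log0=-\infty$). Let $W^{p,\theta}_{\mathcal{M}}$ be the completion of $\mathscr{S}^{\circledast}_{p,\theta,\mathcal{M}}$ with respect to the quasinorm $\|\cdot\|_{p,\mathcal{M}}$, and let $\boldsymbol\pi:W^{p,\theta}_{\mathcal{M}}\to L^p\times L^p\times\cdots$ be the canonical map, i.e. the coordinatewise continuous extension of the map $f\mapsto(f,f',f'',\dots)$ on test functions $f\in\mathscr{S}^{\circledast}_{p,\theta,\mathcal{M}}$. Let $\ell^\infty(L^p,\mathcal{M})$ be the space of sequences $(f_n)_{n\ge0}$ in $L^p$ with $\sup_n\|f_n\|_p/M_n<\infty$, and let $c_0(L^p,\mathcal{M})$ be its subspace of sequences with $\lim_{n\to\infty}\|f_n\|_p/M_n=0$. Then $$c_0(L^p,\mathcal{M})\subset\boldsymbol\pi W^{p,\theta}_{\mathcal{M}}\subset\ell^\infty(L^p,\mathcal{M}).$$ In particular, for every sequence $(f_n)_{n\ge0}$ in $L^p$ with $\|f_n\|_p/M_n\to0$ there is an $F\in W^{p,\theta}_{\mathcal{M}}$ with $\boldsymbol\pi F=(f_0,f_1,f_2,\dots)$. -/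

import Mathlib

open MeasureTheory Filter Topology Set
open scoped ENNReal Uniformity

noncomputable section

/-! ### The uniform structure of a quasinorm -/

/-- `d` is a quasi-distance, with the finite constant `C` in the quasi-triangle inequality. -/
structure IsQuasiDist {α : Type*} (d : α → α → ℝ≥0∞) (C : ℝ≥0∞) : Prop where
  const_ne_top : C ≠ ∞
  self : ∀ x, d x x = 0
  symm : ∀ x y, d x y = d y x
  triangle : ∀ x y z, d x z ≤ C * (d x y + d y z)

/-- The uniform structure on `α` whose entourages are generated by the sets `{(x, y) | d x y < ε}`,
`ε > 0`, for a quasi-distance `d`. -/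
@[reducible]
def quasiUniformSpace {α : Type*} {d : α → α → ℝ≥0∞} {C : ℝ≥0∞} (hd : IsQuasiDist d C) :
    UniformSpace α :=
  .ofCore
    { uniformity := ⨅ ε > (0 : ℝ≥0∞), 𝓟 {q : α × α | d q.1 q.2 < ε}
      refl := le_iInf₂ fun ε hε => by
        rw [principal_mono]
        rintro ⟨x, y⟩ (rfl : x = y)
        simpa [hd.self] using hε
      symm := tendsto_iInf_iInf fun ε => tendsto_iInf_iInf fun _ => by
        rw [tendsto_principal_principal]
        rintro ⟨x, y⟩ h
        simpa [hd.symm y x] using h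
      comp := by
        refine le_iInf₂ fun ε hε => ?_
        obtain ⟨δ, hδ, hδε⟩ : ∃ δ > (0 : ℝ≥0∞), C * (δ + δ) < ε := by
          rcases eq_or_ne C 0 with rfl | hC0
          · exact ⟨1, one_pos, by simpa using hε⟩
          · obtain ⟨η, hη, hηε⟩ := exists_between (a₁ := (0 : ℝ≥0∞)) (a₂ := ε) hε
            refine ⟨η / C / 2, ?_, ?_⟩
            · exact ENNReal.half_pos (ENNReal.div_pos hη.ne' hd.const_ne_top).ne'
            · rw [ENNReal.add_halves, ENNReal.mul_div_cancel hC0 hd.const_ne_top]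
              exact hηε
        refine le_trans (lift'_le (mem_iInf_of_mem δ (mem_iInf_of_mem hδ (mem_principal_self _)))
          le_rfl) ?_
        rw [principal_mono]
        rintro ⟨x, z⟩ ⟨y, hxy, hyz⟩
        have hxy' : d x y < δ := hxy
        have hyz' : d y z < δ := hyz
        exact (hd.triangle x y z).trans_lt
          ((mul_le_mul_right (add_le_add hxy'.le hyz'.le) C).trans_lt hδε) }

theorem quasiUniformSpace_hasBasis {α : Type*} {d : α → α → ℝ≥0∞} {C : ℝ≥0∞}
    (hd : IsQuasiDist d C) :
    (𝓤[quasiUniformSpace hd]).HasBasis (fun ε : ℝ≥0∞ => 0 < ε)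
      fun ε => {q : α × α | d q.1 q.2 < ε} := by
  change (⨅ ε > (0 : ℝ≥0∞), 𝓟 {q : α × α | d q.1 q.2 < ε}).HasBasis _ _
  refine hasBasis_biInf_principal (fun a ha b hb => ⟨min a b, ?_, ?_, ?_⟩) ⟨1, ?_⟩
  · exact lt_min (show 0 < a from ha) (show 0 < b from hb)
  · intro q hq
    exact lt_of_lt_of_le (show d q.1 q.2 < min a b from hq) (min_le_left _ _)
  · intro q hq
    exact lt_of_lt_of_le (show d q.1 q.2 < min a b from hq) (min_le_right _ _)
  · exact (one_pos : (0 : ℝ≥0∞) < 1)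

/-! ### The space `L^p(ℝ)` with its quasinorm -/

/-- `L^p(ℝ)`, as a space of classes of functions modulo equality almost everywhere, to be equipped
with the uniform structure of its quasinorm (Mathlib topologizes `Lp` only for `1 ≤ p`). -/
def LpSpace (𝕜 : Type*) [RCLike 𝕜] (p : ℝ) : Type _ :=
  Lp 𝕜 (ENNReal.ofReal p) (volume : Measure ℝ)

instance (𝕜 : Type*) [RCLike 𝕜] (p : ℝ) : AddCommGroup (LpSpace 𝕜 p) :=
  inferInstanceAs (AddCommGroup (Lp 𝕜 (ENNReal.ofReal p) (volume : Measure ℝ)))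

/-- The underlying (class of) function(s) of an element of `L^p(ℝ)`. -/
def LpSpace.toLp {𝕜 : Type*} [RCLike 𝕜] {p : ℝ} (f : LpSpace 𝕜 p) :
    Lp 𝕜 (ENNReal.ofReal p) (volume : Measure ℝ) := f

/-- The element of `L^p(ℝ)` given by a `p`-integrable function. -/
def LpSpace.ofMemLp {𝕜 : Type*} [RCLike 𝕜] {p : ℝ} (f : ℝ → 𝕜)
    (hf : MemLp f (ENNReal.ofReal p) (volume : Measure ℝ)) : LpSpace 𝕜 p :=
  hf.toLp f

theorem LpSpace.coeFn_ofMemLp {𝕜 : Type*} [RCLike 𝕜] {p : ℝ} {f : ℝ → 𝕜}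
    (hf : MemLp f (ENNReal.ofReal p) (volume : Measure ℝ)) :
    ⇑(LpSpace.ofMemLp f hf).toLp =ᵐ[volume] f :=
  hf.coeFn_toLp

/-- The quasinorm `‖f‖_p` of `L^p(ℝ)`. -/
def LpSpace.qnorm {𝕜 : Type*} [RCLike 𝕜] {p : ℝ} (f : LpSpace 𝕜 p) : ℝ≥0∞ :=
  eLpNorm f.toLp (ENNReal.ofReal p) volume

theorem LpSpace.qnorm_sub {𝕜 : Type*} [RCLike 𝕜] {p : ℝ} (f g : LpSpace 𝕜 p) :
    (f - g).qnorm = eLpNorm (⇑f.toLp - ⇑g.toLp) (ENNReal.ofReal p) volume :=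
  eLpNorm_congr_ae (Lp.coeFn_sub f.toLp g.toLp)

theorem LpSpace.isQuasiDist (𝕜 : Type*) [RCLike 𝕜] (p : ℝ) :
    IsQuasiDist (fun f g : LpSpace 𝕜 p => (f - g).qnorm)
      (ENNReal.LpAddConst (ENNReal.ofReal p)) where
  const_ne_top := (ENNReal.LpAddConst_lt_top _).ne
  self f := by rw [LpSpace.qnorm_sub, sub_self, eLpNorm_zero]
  symm f g := by simp only [LpSpace.qnorm_sub]; exact eLpNorm_sub_comm _ _ _ _
  triangle f g h := by
    simp only [LpSpace.qnorm_sub]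
    have := eLpNorm_add_le' ((Lp.aestronglyMeasurable f.toLp).sub (Lp.aestronglyMeasurable g.toLp))
      ((Lp.aestronglyMeasurable g.toLp).sub (Lp.aestronglyMeasurable h.toLp)) (ENNReal.ofReal p)
    rwa [sub_add_sub_cancel] at this

/-- `L^p(ℝ)` carries the uniform structure of its quasinorm. -/
instance (𝕜 : Type*) [RCLike 𝕜] (p : ℝ) : UniformSpace (LpSpace 𝕜 p) :=
  quasiUniformSpace (LpSpace.isQuasiDist 𝕜 p)

/-! ### Weight sequences -/

/-- The `p`-characteristic `κ(p, M) = limsup_n ∑_{j=1}^n (1-p)^j log M_j`. -/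
def pCharacteristic (p : ℝ) (M : ℕ → ℝ) : EReal :=
  limsup (fun n : ℕ => ((∑ j ∈ Finset.Icc 1 n, (1 - p) ^ j * Real.log (M j) : ℝ) : EReal)) atTop

/-- `p`-regular weight sequences (with infinite `p`-characteristic). -/
structure IsPRegular (p : ℝ) (M : ℕ → ℝ) : Prop where
  pos : ∀ n, 0 < M n
  logConvex : ∀ n, 2 * Real.log (M (n + 1)) ≤ Real.log (M n) + Real.log (M (n + 2))
  char_eq_top : pCharacteristic p M = ⊤
  regular :
    0 < liminf (fun n : ℕ => (((1 - p) ^ n * Real.log (M n) : ℝ) : EReal)) atTop ∨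
    ((fun n : ℕ => Real.log (M n)) =o[atTop] (fun n : ℕ => ((1 - p) ^ n)⁻¹) ∧
      ∃ δ : ℝ, δ < 1 ∧ ∃ e : ℕ → ℝ, Tendsto e atTop (𝓝 0) ∧
        ∀ᶠ n : ℕ in atTop, (n : ℝ) * Real.log n ≤ (δ + e n) * Real.log (M n))

/-! ### The quasinorm `‖·‖_{p,M}`, the test functions, and the Carleman space -/

/-- The quasinorm `‖f‖_{p,M} = sup_k ‖f^{(k)}‖_p / M_k`. -/
def carlemanQNorm {𝕜 : Type*} [RCLike 𝕜] (p : ℝ) (M : ℕ → ℝ) (f : ℝ → 𝕜) : ℝ≥0∞ :=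
  ⨆ k : ℕ, eLpNorm (iteratedDeriv k f) (ENNReal.ofReal p) volume / ENNReal.ofReal (M k)

/-- The test function class: the `f ∈ C^∞(ℝ)` with `‖f‖_{p,M} < ∞` and
`limsup_n (1-p)^n log ‖f^{(n)}‖_∞ ≤ θ`, where `log 0 = -∞` and `log ∞ = ∞`. -/
def CarlemanTest (𝕜 : Type*) [RCLike 𝕜] (p θ : ℝ) (M : ℕ → ℝ) : Type _ :=
  {f : ℝ → 𝕜 // ContDiff ℝ (⊤ : ℕ∞) f ∧ carlemanQNorm p M f < ∞ ∧
    limsup (fun n : ℕ => (((1 - p) ^ n : ℝ) : EReal) *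
      ENNReal.log (eLpNorm (iteratedDeriv n f) ∞ volume)) atTop ≤ (θ : EReal)}

theorem CarlemanTest.iteratedDeriv_sub {𝕜 : Type*} [RCLike 𝕜] {p θ : ℝ} {M : ℕ → ℝ}
    (f g : CarlemanTest 𝕜 p θ M) (k : ℕ) :
    iteratedDeriv k (f.1 - g.1) = iteratedDeriv k f.1 - iteratedDeriv k g.1 := by
  ext x
  exact _root_.iteratedDeriv_sub (f.2.1.contDiffAt.of_le (mod_cast le_top))
    (g.2.1.contDiffAt.of_le (mod_cast le_top))

theorem CarlemanTest.aestronglyMeasurable {𝕜 : Type*} [RCLike 𝕜] {p θ : ℝ} {M : ℕ → ℝ}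
    (f : CarlemanTest 𝕜 p θ M) (k : ℕ) :
    AEStronglyMeasurable (iteratedDeriv k f.1) (volume : Measure ℝ) :=
  (f.2.1.continuous_iteratedDeriv k (mod_cast le_top)).aestronglyMeasurable

theorem CarlemanTest.isQuasiDist (𝕜 : Type*) [RCLike 𝕜] (p θ : ℝ) (M : ℕ → ℝ) :
    IsQuasiDist (fun f g : CarlemanTest 𝕜 p θ M => carlemanQNorm p M (f.1 - g.1))
      (ENNReal.LpAddConst (ENNReal.ofReal p)) where
  const_ne_top := (ENNReal.LpAddConst_lt_top _).ne
  self f := by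
    unfold carlemanQNorm
    simp_rw [CarlemanTest.iteratedDeriv_sub, sub_self, eLpNorm_zero, ENNReal.zero_div, iSup_const]
  symm f g := by
    simp only [carlemanQNorm, CarlemanTest.iteratedDeriv_sub]
    exact iSup_congr fun k => by rw [eLpNorm_sub_comm]
  triangle f g h := by
    simp only [carlemanQNorm, CarlemanTest.iteratedDeriv_sub]
    refine iSup_le fun k => ?_
    have h1 := eLpNorm_add_le' ((f.aestronglyMeasurable k).sub (g.aestronglyMeasurable k))
      ((g.aestronglyMeasurable k).sub (h.aestronglyMeasurable k)) (ENNReal.ofReal p)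
    rw [sub_add_sub_cancel] at h1
    refine (ENNReal.div_le_div_right h1 _).trans ?_
    rw [mul_div_assoc, ENNReal.add_div]
    refine mul_le_mul_right (add_le_add ?_ ?_) _
    · exact le_iSup (fun k => eLpNorm (iteratedDeriv k f.1 - iteratedDeriv k g.1)
        (ENNReal.ofReal p) volume / ENNReal.ofReal (M k)) k
    · exact le_iSup (fun k => eLpNorm (iteratedDeriv k g.1 - iteratedDeriv k h.1)
        (ENNReal.ofReal p) volume / ENNReal.ofReal (M k)) k

/-- The test functions carry the uniform structure of the quasinorm `‖·‖_{p,M}`. -/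
instance (𝕜 : Type*) [RCLike 𝕜] (p θ : ℝ) (M : ℕ → ℝ) : UniformSpace (CarlemanTest 𝕜 p θ M) :=
  quasiUniformSpace (CarlemanTest.isQuasiDist 𝕜 p θ M)

/-- The `L^p`-Carleman space `W^{p,θ}_M`: the abstract completion of the test function class with
respect to the quasinorm `‖·‖_{p,M}`. -/
abbrev CarlemanSpace (𝕜 : Type*) [RCLike 𝕜] (p θ : ℝ) (M : ℕ → ℝ) : Type _ :=
  UniformSpace.Completion (CarlemanTest 𝕜 p θ M)

/-! ### The canonical map `π` -/

theorem CarlemanTest.memLp {𝕜 : Type*} [RCLike 𝕜] {p θ : ℝ} {M : ℕ → ℝ}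
    (f : CarlemanTest 𝕜 p θ M) (k : ℕ) :
    MemLp (iteratedDeriv k f.1) (ENNReal.ofReal p) (volume : Measure ℝ) := by
  refine ⟨f.aestronglyMeasurable k, lt_top_iff_ne_top.2 fun htop => ?_⟩
  have h := (le_iSup (fun k => eLpNorm (iteratedDeriv k f.1)
    (ENNReal.ofReal p) volume / ENNReal.ofReal (M k)) k).trans_lt f.2.2.1
  simp [htop, ENNReal.top_div_of_ne_top] at h

/-- The `n`-th derivative of a test function, as an element of `L^p(ℝ)`. -/
def CarlemanTest.derivLp {𝕜 : Type*} [RCLike 𝕜] {p θ : ℝ} {M : ℕ → ℝ} (n : ℕ)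
    (f : CarlemanTest 𝕜 p θ M) : LpSpace 𝕜 p :=
  LpSpace.ofMemLp (iteratedDeriv n f.1) (f.memLp n)

/-- The canonical map `π : W^{p,θ}_M → L^p × L^p × ⋯`, the coordinatewise continuous extension to
the completion of `f ↦ (f, f', f'', …)` on test functions. -/
def carlemanPi {𝕜 : Type*} [RCLike 𝕜] {p θ : ℝ} {M : ℕ → ℝ} (F : CarlemanSpace 𝕜 p θ M) :
    ℕ → LpSpace 𝕜 p :=
  fun n => UniformSpace.Completion.extension (CarlemanTest.derivLp n) F

/-! ### The sequence spaces -/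

/-- `ℓ^∞(L^p, M)`: the sequences in `L^p` with `sup_n ‖f_n‖_p / M_n < ∞`. -/
def ellInftyLp (𝕜 : Type*) [RCLike 𝕜] (p : ℝ) (M : ℕ → ℝ) : Set (ℕ → LpSpace 𝕜 p) :=
  {f | ⨆ n, (f n).qnorm / ENNReal.ofReal (M n) < ∞}

/-- `c_0(L^p, M)`: the sequences in `ℓ^∞(L^p, M)` with `‖f_n‖_p / M_n → 0`. -/
def cZeroLp (𝕜 : Type*) [RCLike 𝕜] (p : ℝ) (M : ℕ → ℝ) : Set (ℕ → LpSpace 𝕜 p) :=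
  {f | f ∈ ellInftyLp 𝕜 p M ∧
    Tendsto (fun n => (f n).qnorm / ENNReal.ofReal (M n)) atTop (𝓝 0)}

/-! ### The canonical map is well defined -/

theorem LpSpace.hasBasis_uniformity (𝕜 : Type*) [RCLike 𝕜] (p : ℝ) :
    (𝓤 (LpSpace 𝕜 p)).HasBasis (fun ε : ℝ≥0∞ => 0 < ε) fun ε => {q | (q.1 - q.2).qnorm < ε} :=
  quasiUniformSpace_hasBasis (LpSpace.isQuasiDist 𝕜 p)

theorem CarlemanTest.hasBasis_uniformity (𝕜 : Type*) [RCLike 𝕜] (p θ : ℝ) (M : ℕ → ℝ) :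
    (𝓤 (CarlemanTest 𝕜 p θ M)).HasBasis (fun ε : ℝ≥0∞ => 0 < ε)
      fun ε => {q | carlemanQNorm p M (q.1.1 - q.2.1) < ε} :=
  quasiUniformSpace_hasBasis (CarlemanTest.isQuasiDist 𝕜 p θ M)

theorem CarlemanTest.uniformContinuous_derivLp {𝕜 : Type*} [RCLike 𝕜] {p θ : ℝ} {M : ℕ → ℝ}
    (n : ℕ) : UniformContinuous (CarlemanTest.derivLp n : CarlemanTest 𝕜 p θ M → LpSpace 𝕜 p) := by
  rw [(CarlemanTest.hasBasis_uniformity 𝕜 p θ M).uniformContinuous_iff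
    (LpSpace.hasBasis_uniformity 𝕜 p)]
  intro ε hε
  refine ⟨ε / (ENNReal.ofReal (M n) + 1), ENNReal.div_pos hε.ne' (by simp), fun f g h => ?_⟩
  have h' : carlemanQNorm p M (f.1 - g.1) < ε / (ENNReal.ofReal (M n) + 1) := h
  have h1 : eLpNorm (iteratedDeriv n f.1 - iteratedDeriv n g.1) (ENNReal.ofReal p) volume /
      ENNReal.ofReal (M n) < ε / (ENNReal.ofReal (M n) + 1) := by
    refine lt_of_le_of_lt ?_ h'
    rw [← CarlemanTest.iteratedDeriv_sub]
    exact le_iSup (fun k => eLpNorm (iteratedDeriv k (f.1 - g.1)) (ENNReal.ofReal p) volume /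
      ENNReal.ofReal (M k)) n
  have h2 : (CarlemanTest.derivLp n f - CarlemanTest.derivLp n g).qnorm =
      eLpNorm (iteratedDeriv n f.1 - iteratedDeriv n g.1) (ENNReal.ofReal p) volume := by
    rw [LpSpace.qnorm_sub]
    exact eLpNorm_congr_ae
      ((LpSpace.coeFn_ofMemLp (f.memLp n)).sub (LpSpace.coeFn_ofMemLp (g.memLp n)))
  change (CarlemanTest.derivLp n f - CarlemanTest.derivLp n g).qnorm < ε
  rw [h2]
  generalize eLpNorm (iteratedDeriv n f.1 - iteratedDeriv n g.1) (ENNReal.ofReal p) volume = x at h1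
  rcases eq_or_ne (ENNReal.ofReal (M n)) 0 with hM | hM
  · rcases eq_or_ne x 0 with rfl | hx
    · exact hε
    · simp [hM, ENNReal.div_zero hx] at h1
  · rw [ENNReal.div_lt_iff (Or.inl hM) (Or.inl ENNReal.ofReal_ne_top)] at h1
    refine h1.trans_le ?_
    calc ε / (ENNReal.ofReal (M n) + 1) * ENNReal.ofReal (M n)
        ≤ ε / (ENNReal.ofReal (M n) + 1) * (ENNReal.ofReal (M n) + 1) := by gcongr; simp
      _ = ε := ENNReal.div_mul_cancel (by simp) (by simp)

theorem LpSpace.t0Space {𝕜 : Type*} [RCLike 𝕜] {p : ℝ} (hp : 0 < p) : T0Space (LpSpace 𝕜 p) := by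
  rw [t0Space_iff_uniformity]
  intro f g hfg
  have h0 : (f - g).qnorm = 0 := by
    by_contra h
    have h1 : (f - g).qnorm < (f - g).qnorm :=
      hfg _ ((LpSpace.hasBasis_uniformity 𝕜 p).mem_of_mem (pos_iff_ne_zero.2 h))
    exact lt_irrefl _ h1
  rw [LpSpace.qnorm_sub, eLpNorm_eq_zero_iff ((Lp.aestronglyMeasurable f.toLp).sub
    (Lp.aestronglyMeasurable g.toLp)) (by simpa using hp)] at h0
  have h1 : f.toLp = g.toLp := Lp.ext (h0.mono fun x hx => sub_eq_zero.1 hx)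
  exact h1

/-- `L^p(ℝ)` is complete for `0 < p ≤ 1`. -/
theorem LpSpace.completeSpace {𝕜 : Type*} [RCLike 𝕜] {p : ℝ} (hp : 0 < p) (hp1 : p ≤ 1) :
    CompleteSpace (LpSpace 𝕜 p) := by
  have hp0 : ENNReal.ofReal p ≠ 0 := by simpa using hp
  have hB0 : ∀ n : ℕ, (0 : ℝ≥0∞) < (2⁻¹ : ℝ≥0∞) ^ n := fun n =>
    ENNReal.pow_pos (by simp) n
  have : (𝓤 (LpSpace 𝕜 p)).IsCountablyGenerated := by
    refine (HasBasis.mk (p := fun _ : ℕ => True)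
      (s := fun n => {q : LpSpace 𝕜 p × LpSpace 𝕜 p | (q.1 - q.2).qnorm < 2⁻¹ ^ n})
      fun t => ?_).isCountablyGenerated
    rw [(LpSpace.hasBasis_uniformity 𝕜 p).mem_iff]
    constructor
    · rintro ⟨ε, hε, h⟩
      obtain ⟨n, hn⟩ := ENNReal.exists_inv_two_pow_lt hε.ne'
      exact ⟨n, trivial, fun q hq => h (lt_trans hq hn)⟩
    · rintro ⟨n, -, h⟩
      exact ⟨_, hB0 n, h⟩
  -- a rapidly Cauchy sequence converges almost everywhere, and then in quasinorm by Fatou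
  refine UniformSpace.complete_of_convergent_controlled_sequences
    (fun n => {q : LpSpace 𝕜 p × LpSpace 𝕜 p | (q.1 - q.2).qnorm < 2⁻¹ ^ n})
    (fun n => (LpSpace.hasBasis_uniformity 𝕜 p).mem_of_mem (hB0 n)) fun u hu => ?_
  set v : ℕ → ℝ → 𝕜 := fun n => ⇑(u n).toLp with hv
  have hvm : ∀ n, AEStronglyMeasurable (v n) volume := fun n => Lp.aestronglyMeasurable (u n).toLp
  have hcau : ∀ N n m : ℕ, N ≤ n → N ≤ m →
      eLpNorm (v n - v m) (ENNReal.ofReal p) volume < 2⁻¹ ^ N := by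
    intro N n m hn hm
    have h : (u n - u m).qnorm < 2⁻¹ ^ N := hu N n m hn hm
    rwa [LpSpace.qnorm_sub] at h
  have hBsum : ∑' n : ℕ, (2⁻¹ : ℝ≥0∞) ^ n ≠ ∞ := by
    rw [ENNReal.tsum_geometric]
    simp
  have hstep : ∀ n, ∫⁻ x, ‖v (n + 1) x - v n x‖ₑ ^ p ≤ ((2⁻¹ : ℝ≥0∞) ^ p) ^ n := by
    intro n
    have h := (hcau n (n + 1) n n.le_succ le_rfl).le
    rw [eLpNorm_eq_lintegral_rpow_enorm_toReal hp0 ENNReal.ofReal_ne_top,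
      ENNReal.toReal_ofReal hp.le] at h
    have h2 := ENNReal.rpow_le_rpow h hp.le
    rw [← ENNReal.rpow_mul, one_div, inv_mul_cancel₀ hp.ne', ENNReal.rpow_one] at h2
    refine h2.trans (le_of_eq ?_)
    rw [← ENNReal.rpow_natCast, ← ENNReal.rpow_natCast, ← ENNReal.rpow_mul, ← ENNReal.rpow_mul,
      mul_comm]
  have hmeas : ∀ n, AEMeasurable (fun x => ‖v (n + 1) x - v n x‖ₑ ^ p) volume :=
    fun n => ((hvm (n + 1)).sub (hvm n)).enorm.pow_const p
  have hint : ∫⁻ x, ∑' n, ‖v (n + 1) x - v n x‖ₑ ^ p ≠ ∞ := by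
    rw [lintegral_tsum hmeas]
    refine ne_top_of_le_ne_top ?_ (ENNReal.tsum_le_tsum hstep)
    rw [ENNReal.tsum_geometric]
    refine ENNReal.inv_ne_top.2 (tsub_pos_of_lt ?_).ne'
    exact ENNReal.rpow_lt_one (by simp) hp
  have hae : ∀ᵐ x ∂(volume : Measure ℝ), ∃ l : 𝕜, Tendsto (fun n => v n x) atTop (𝓝 l) := by
    have h1 := ae_lt_top' (AEMeasurable.tsum hmeas) hint
    filter_upwards [h1] with x hx
    have hsum : Summable fun n => ‖v (n + 1) x - v n x‖ ^ p := by
      have h3 := ENNReal.summable_toReal hx.ne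
      refine h3.congr fun n => ?_
      rw [← ENNReal.toReal_rpow, toReal_enorm]
    have hsum' : Summable fun n => ‖v (n + 1) x - v n x‖ := by
      refine hsum.of_norm_bounded_eventually_nat ?_
      filter_upwards [hsum.tendsto_atTop_zero.eventually (gt_mem_nhds one_pos)] with n hn
      rw [norm_norm]
      have h4 : ‖v (n + 1) x - v n x‖ ≤ 1 := by
        by_contra! h5
        exact absurd hn (not_lt.2 (Real.one_le_rpow h5.le hp.le))
      calc ‖v (n + 1) x - v n x‖ = ‖v (n + 1) x - v n x‖ ^ (1 : ℝ) := (Real.rpow_one _).symm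
        _ ≤ _ := Real.rpow_le_rpow_of_exponent_ge_of_imp (norm_nonneg _) h4 hp1
          (by intro _ h6; exact absurd h6 one_ne_zero)
    refine cauchySeq_tendsto_of_complete (cauchySeq_of_summable_dist ?_)
    refine hsum'.congr fun n => ?_
    rw [dist_comm, dist_eq_norm]
  obtain ⟨w, hwm, hw⟩ := exists_stronglyMeasurable_limit_of_tendsto_ae hvm hae
  have hlim := Lp.cauchy_tendsto_of_tendsto (p := ENNReal.ofReal p) hvm w hBsum hcau hw
  have hwp : MemLp w (ENNReal.ofReal p) volume := by
    obtain ⟨n, hn⟩ := (hlim.eventually (gt_mem_nhds one_pos)).exists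
    have h1 : MemLp (v n - w) (ENNReal.ofReal p) volume :=
      ⟨(hvm n).sub hwm.aestronglyMeasurable, hn.trans ENNReal.one_lt_top⟩
    have h2 := (Lp.memLp (u n).toLp).sub h1
    simpa [hv] using h2
  refine ⟨LpSpace.ofMemLp w hwp, ?_⟩
  rw [(nhds_basis_uniformity (LpSpace.hasBasis_uniformity 𝕜 p)).tendsto_right_iff]
  intro ε hε
  filter_upwards [hlim.eventually (gt_mem_nhds hε)] with n hn
  rw [LpSpace.qnorm_sub]
  refine lt_of_eq_of_lt (eLpNorm_congr_ae ?_) hn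
  exact (EventuallyEq.refl _ _).sub (LpSpace.coeFn_ofMemLp hwp)

/-- On test functions, `π f = (f, f', f'', …)`. -/
theorem carlemanPi_coe {𝕜 : Type*} [RCLike 𝕜] {p θ : ℝ} {M : ℕ → ℝ} (hp : 0 < p)
    (f : CarlemanTest 𝕜 p θ M) (n : ℕ) :
    carlemanPi (f : CarlemanSpace 𝕜 p θ M) n = CarlemanTest.derivLp n f :=
  have := LpSpace.t0Space (𝕜 := 𝕜) hp
  UniformSpace.Completion.extension_coe (CarlemanTest.uniformContinuous_derivLp n) f

/-- The coordinates of `π` are continuous. -/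
theorem continuous_carlemanPi {𝕜 : Type*} [RCLike 𝕜] {p θ : ℝ} {M : ℕ → ℝ} (hp : 0 < p)
    (hp1 : p ≤ 1) (n : ℕ) : Continuous fun F : CarlemanSpace 𝕜 p θ M => carlemanPi F n :=
  have := LpSpace.completeSpace (𝕜 := 𝕜) hp hp1
  UniformSpace.Completion.continuous_extension

end

/-!
Since `p < 1`, the functional `f ↦ ∫ |f| ^ p` is subadditive, and functions with huge derivatives
can be small. Averaging the Heaviside function over intervals of lengths `a₀, a₁, …` with finite
sum gives a smooth `H` with
`∫ |H⁽ᵏ⁺¹⁾| ^ p ≤ 2 ^ k (∏_{j ≤ k} a_j ^ (-p)) ∑_{j ≥ k} a_j`. Infinite `p`-characteristic is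
exactly what allows the lengths to be chosen such that this is at most `ε M_{k+1} ^ p` for all `k`:
the `log a_j` are weighted averages of truncated increments of `log M`.

Multiplying the plateau `H(x) - H(x - ℓ)` by `x ^ n / n!` gives a function whose `n`-th derivative
is close to the indicator of `[0, ℓ)`, whose higher derivatives are tiny, and whose lower
derivatives contribute `O(ℓ ^ (1 + p))`. A sum of about `1 / ℓ` translates therefore has lower
derivatives of size `O(ℓ ^ p)`: a step function, hence any function in `L ^ p`, can be put in the
`n`-th coordinate alone. Finitely supported sequences are dense in `c₀(L ^ p, M)`, and completeness
of `W` turns approximation into equality.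
-/

noncomputable section

/-! ### The integral of the `p`-th power -/

section PowIntegral

variable {α E F : Type*} [MeasurableSpace α] [NormedAddCommGroup E] [NormedAddCommGroup F]
  {μ : Measure α} {p : ℝ} {f : α → E}

/-- The integral `∫ ‖f‖ ^ p ∂μ`, the `p`-th power of the quasinorm. It is subadditive in `f` for
`0 < p ≤ 1`. -/
def powIntegral (p : ℝ) (f : α → E) (μ : Measure α := by volume_tac) : ℝ≥0∞ :=
  ∫⁻ x, ‖f x‖ₑ ^ p ∂μ

theorem powIntegral_mono (hp : 0 ≤ p) {g : α → F} (h : ∀ x, ‖f x‖ ≤ ‖g x‖) :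
    powIntegral p f μ ≤ powIntegral p g μ :=
  lintegral_mono fun x => ENNReal.rpow_le_rpow (enorm_le_iff_norm_le.2 (h x)) hp

theorem powIntegral_zero (hp : 0 < p) : powIntegral p (0 : α → E) μ = 0 := by
  simp [powIntegral, hp]

theorem powIntegral_add_le (hp : 0 ≤ p) (hp1 : p ≤ 1) (hf : AEStronglyMeasurable f μ)
    (g : α → E) : powIntegral p (f + g) μ ≤ powIntegral p f μ + powIntegral p g μ := by
  unfold powIntegral
  rw [← lintegral_add_left' (hf.enorm.pow_const p)]
  exact lintegral_mono fun x => (ENNReal.rpow_le_rpow (enorm_add_le _ _) hp).trans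
    (ENNReal.rpow_add_le_add_rpow _ _ hp hp1)

theorem powIntegral_neg (p : ℝ) (f : α → E) : powIntegral p (-f) μ = powIntegral p f μ := by
  simp [powIntegral]

theorem powIntegral_sub_le (hp : 0 ≤ p) (hp1 : p ≤ 1) (hf : AEStronglyMeasurable f μ)
    (g : α → E) : powIntegral p (f - g) μ ≤ powIntegral p f μ + powIntegral p g μ := by
  rw [sub_eq_add_neg, ← powIntegral_neg p g]
  exact powIntegral_add_le hp hp1 hf _

theorem powIntegral_sum_le {ι : Type*} (hp : 0 < p) (hp1 : p ≤ 1) (s : Finset ι)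
    {f : ι → α → E} (hf : ∀ i ∈ s, AEStronglyMeasurable (f i) μ) :
    powIntegral p (∑ i ∈ s, f i) μ ≤ ∑ i ∈ s, powIntegral p (f i) μ := by
  classical
  induction s using Finset.induction_on with
  | empty => simp [powIntegral_zero hp]
  | insert i s hi ih =>
    rw [Finset.sum_insert hi, Finset.sum_insert hi]
    exact (powIntegral_add_le hp.le hp1 (hf i (s.mem_insert_self i)) _).trans
      (add_le_add le_rfl (ih fun j hj => hf j (Finset.mem_insert_of_mem hj)))

theorem powIntegral_const_smul {𝕜 : Type*} [NormedField 𝕜] [NormedSpace 𝕜 E] (hp : 0 ≤ p) (c : 𝕜)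
    (f : α → E) : powIntegral p (c • f) μ = ‖c‖ₑ ^ p * powIntegral p f μ := by
  unfold powIntegral
  rw [← lintegral_const_mul' _ _ (by finiteness)]
  exact lintegral_congr fun x => by
    rw [Pi.smul_apply, enorm_smul, ENNReal.mul_rpow_of_nonneg _ _ hp]

theorem powIntegral_smul_const {𝕜 : Type*} [NormedField 𝕜] [NormedSpace 𝕜 E] (hp : 0 ≤ p)
    (f : α → 𝕜) (c : E) :
    powIntegral p (fun x => f x • c) μ = ‖c‖ₑ ^ p * powIntegral p f μ := by
  unfold powIntegral
  rw [← lintegral_const_mul' _ _ (by finiteness)]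
  exact lintegral_congr fun x => by
    rw [enorm_smul, ENNReal.mul_rpow_of_nonneg _ _ hp, mul_comm]

theorem powIntegral_comp_sub_right [AddGroup α] [MeasurableAdd α] [μ.IsAddRightInvariant] (p : ℝ)
    (f : α → E) (t : α) : powIntegral p (fun x => f (x - t)) μ = powIntegral p f μ :=
  lintegral_sub_right_eq_self (fun x => ‖f x‖ₑ ^ p) t

theorem powIntegral_le_of_norm_le (hp : 0 < p) {C : ℝ} (hC : ∀ x, ‖f x‖ ≤ C) {s : Set α}
    (hs : ∀ x ∉ s, f x = 0) : powIntegral p f μ ≤ ENNReal.ofReal C ^ p * μ s := by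
  refine le_trans (lintegral_mono fun x => ?_) (lintegral_indicator_const_le s _)
  by_cases hx : x ∈ s
  · rw [indicator_of_mem hx, ← ofReal_norm]
    exact ENNReal.rpow_le_rpow (ENNReal.ofReal_le_ofReal (hC x)) hp.le
  · simp [hs x hx, hp]

theorem powIntegral_le_of_norm_le_of_Icc (hp : 0 < p) {f : ℝ → E} {C a b : ℝ}
    (hC : ∀ x, ‖f x‖ ≤ C) (h : ∀ x ∉ Icc a b, f x = 0) :
    powIntegral p f ≤ ENNReal.ofReal (C ^ p * (b - a)) := by
  have hC0 : 0 ≤ C := (norm_nonneg _).trans (hC 0)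
  refine (powIntegral_le_of_norm_le hp hC h).trans_eq ?_
  rw [Real.volume_Icc, ENNReal.ofReal_rpow_of_nonneg hC0 hp.le,
    ENNReal.ofReal_mul (Real.rpow_nonneg hC0 p)]

theorem eLpNorm_rpow_eq_powIntegral (hp : 0 < p) (f : α → E) :
    eLpNorm f (ENNReal.ofReal p) μ ^ p = powIntegral p f μ := by
  rw [eLpNorm_eq_lintegral_rpow_enorm_toReal (by simpa using hp) ENNReal.ofReal_ne_top,
    ENNReal.toReal_ofReal hp.le, one_div, ENNReal.rpow_inv_rpow hp.ne', powIntegral]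

end PowIntegral

/-! ### Infinite convolutions of box functions -/

/-- The average of `u` over the interval `[x - a, x]`, written as an integral over `[0, 1]` so that
it also makes sense for `a = 0`. -/
def boxAverage (a : ℝ) (u : ℝ → ℝ) (x : ℝ) : ℝ := ∫ t in (0 : ℝ)..1, u (x - a * t)

theorem boxAverage_eq_inv_mul_integral {a : ℝ} (ha : a ≠ 0) (u : ℝ → ℝ) (x : ℝ) :
    boxAverage a u x = a⁻¹ * ∫ t in (x - a)..x, u t := by
  unfold boxAverage
  rw [intervalIntegral.integral_comp_sub_mul u ha x]
  simp

theorem boxAverage_eq_of_forall {a c x : ℝ} {u : ℝ → ℝ}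
    (h : ∀ t ∈ Icc (0 : ℝ) 1, u (x - a * t) = c) : boxAverage a u x = c := by
  unfold boxAverage
  rw [intervalIntegral.integral_congr (g := fun _ => c) (by rwa [uIcc_of_le zero_le_one])]
  simp

/-- Monotone functions with values in `[0, 1]`: the functions that are averaged below. -/
structure IsUnitMonotone (u : ℝ → ℝ) : Prop where
  mono : Monotone u
  nonneg : ∀ x, 0 ≤ u x
  le_one : ∀ x, u x ≤ 1

namespace IsUnitMonotone

variable {u v : ℝ → ℝ}

theorem abs_sub_le_one (hu : IsUnitMonotone u) (x y : ℝ) : |u x - u y| ≤ 1 := by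
  rw [abs_le]
  constructor <;> linarith [hu.nonneg x, hu.le_one x, hu.nonneg y, hu.le_one y]

theorem indicator_Ici_one (c : ℝ) : IsUnitMonotone ((Ici c).indicator 1) where
  mono x y hxy := by
    simp only [indicator, mem_Ici, Pi.one_apply]
    split_ifs <;> linarith
  nonneg := indicator_nonneg fun _ _ => zero_le_one
  le_one := indicator_le_self' (fun _ _ => zero_le_one)

theorem intervalIntegrable_comp_sub_mul (hu : IsUnitMonotone u) {a : ℝ} (ha : 0 ≤ a)
    (x b c : ℝ) : IntervalIntegrable (fun t => u (x - a * t)) volume b c :=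
  Antitone.intervalIntegrable fun s t hst => hu.mono (by gcongr)

theorem boxAverage_le_boxAverage (hu : IsUnitMonotone u) (hv : IsUnitMonotone v) {a : ℝ}
    (ha : 0 ≤ a) {x y : ℝ} (h : ∀ t ∈ Icc (0 : ℝ) 1, u (x - a * t) ≤ v (y - a * t)) :
    boxAverage a u x ≤ boxAverage a v y :=
  intervalIntegral.integral_mono_on zero_le_one (hu.intervalIntegrable_comp_sub_mul ha _ _ _)
    (hv.intervalIntegrable_comp_sub_mul ha _ _ _) h

theorem boxAverage (hu : IsUnitMonotone u) {a : ℝ} (ha : 0 ≤ a) :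
    IsUnitMonotone (boxAverage a u) where
  mono x y hxy := hu.boxAverage_le_boxAverage hu ha fun t _ => hu.mono (by linarith)
  nonneg x := intervalIntegral.integral_nonneg zero_le_one fun t _ => hu.nonneg _
  le_one x := (intervalIntegral.integral_mono_on zero_le_one
    (hu.intervalIntegrable_comp_sub_mul ha x 0 1) intervalIntegrable_const
    fun t _ => hu.le_one _).trans_eq (by simp)

end IsUnitMonotone

/-- The Heaviside function averaged successively over intervals of lengths `a (n - 1), …, a 0`. -/
def stepApprox : (ℕ → ℝ) → ℕ → ℝ → ℝ
  | _, 0 => (Ici 0).indicator 1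
  | a, n + 1 => boxAverage (a 0) (stepApprox (fun j => a (j + 1)) n)

/-- The Heaviside function averaged over intervals of all the lengths `a 0, a 1, …`. The averages
decrease, so that the infimum is a limit. -/
def smoothStep (a : ℕ → ℝ) (x : ℝ) : ℝ := ⨅ n, stepApprox a n x

section SmoothStep

variable {a : ℕ → ℝ} (ha : ∀ j, 0 < a j)
include ha

theorem isUnitMonotone_stepApprox (n : ℕ) : IsUnitMonotone (stepApprox a n) := by
  induction n generalizing a with
  | zero => exact .indicator_Ici_one 0
  | succ n ih => exact (ih fun j => ha (j + 1)).boxAverage (ha 0).le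

theorem stepApprox_of_neg (n : ℕ) {x : ℝ} (hx : x < 0) : stepApprox a n x = 0 := by
  induction n generalizing a x with
  | zero => simp [stepApprox, hx]
  | succ n ih =>
    exact boxAverage_eq_of_forall fun t ht =>
      ih (fun j => ha (j + 1)) (by nlinarith [ha 0, ht.1])

theorem stepApprox_of_sum_le (n : ℕ) {x : ℝ} (hx : ∑ j ∈ Finset.range n, a j ≤ x) :
    stepApprox a n x = 1 := by
  induction n generalizing a x with
  | zero => simp_all [stepApprox]
  | succ n ih =>
    rw [Finset.sum_range_succ'] at hx
    exact boxAverage_eq_of_forall fun t ht =>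
      ih (fun j => ha (j + 1)) (by nlinarith [ha 0, ht.2])

theorem stepApprox_succ_le (n : ℕ) (x : ℝ) : stepApprox a (n + 1) x ≤ stepApprox a n x := by
  induction n generalizing a x with
  | zero =>
    rcases lt_or_ge x 0 with hx | hx
    · rw [stepApprox_of_neg ha _ hx, stepApprox_of_neg ha _ hx]
    · rw [stepApprox_of_sum_le ha 0 (by simpa using hx)]
      exact (isUnitMonotone_stepApprox ha 1).le_one x
  | succ n ih =>
    have ha' : ∀ j, 0 < a (j + 1) := fun j => ha (j + 1)
    exact (isUnitMonotone_stepApprox ha' (n + 1)).boxAverage_le_boxAverage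
      (isUnitMonotone_stepApprox ha' n) (ha 0).le fun t _ => ih ha' _

theorem tendsto_stepApprox (x : ℝ) :
    Tendsto (fun n => stepApprox a n x) atTop (𝓝 (smoothStep a x)) :=
  tendsto_atTop_ciInf (antitone_nat_of_succ_le fun n => stepApprox_succ_le ha n x)
    ⟨0, forall_mem_range.2 fun n => (isUnitMonotone_stepApprox ha n).nonneg x⟩

theorem isUnitMonotone_smoothStep : IsUnitMonotone (smoothStep a) where
  mono x y hxy := le_of_tendsto_of_tendsto' (tendsto_stepApprox ha x) (tendsto_stepApprox ha y)
    fun n => (isUnitMonotone_stepApprox ha n).mono hxy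
  nonneg x := ge_of_tendsto' (tendsto_stepApprox ha x)
    fun n => (isUnitMonotone_stepApprox ha n).nonneg x
  le_one x := le_of_tendsto' (tendsto_stepApprox ha x)
    fun n => (isUnitMonotone_stepApprox ha n).le_one x

theorem smoothStep_of_neg {x : ℝ} (hx : x < 0) : smoothStep a x = 0 :=
  tendsto_nhds_unique (tendsto_stepApprox ha x)
    (tendsto_const_nhds.congr fun n => (stepApprox_of_neg ha n hx).symm)

theorem smoothStep_of_tsum_le (hs : Summable a) {x : ℝ} (hx : ∑' j, a j ≤ x) :
    smoothStep a x = 1 :=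
  tendsto_nhds_unique (tendsto_stepApprox ha x) <| tendsto_const_nhds.congr fun n =>
    (stepApprox_of_sum_le ha n ((hs.sum_le_tsum _ fun j _ => (ha j).le).trans hx)).symm

theorem smoothStep_eq_boxAverage (x : ℝ) :
    smoothStep a x = boxAverage (a 0) (smoothStep fun j => a (j + 1)) x := by
  have hu := isUnitMonotone_stepApprox fun j => ha (j + 1)
  refine tendsto_nhds_unique ((tendsto_add_atTop_iff_nat 1).2 (tendsto_stepApprox ha x)) ?_
  refine intervalIntegral.tendsto_integral_filter_of_dominated_convergence (fun _ => (1 : ℝ))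
    (.of_forall fun n => ?_) (.of_forall fun n => .of_forall fun t _ => ?_)
    intervalIntegrable_const
    (.of_forall fun t _ => tendsto_stepApprox (fun j => ha (j + 1)) (x - a 0 * t))
  · exact ((hu n).mono.measurable.comp (by fun_prop)).aestronglyMeasurable
  · exact (Real.norm_of_nonneg ((hu n).nonneg _)).trans_le ((hu n).le_one _)

theorem smoothStep_eq_inv_mul_sub_integral (x : ℝ) :
    smoothStep a x = (a 0)⁻¹ * ((∫ t in (0 : ℝ)..x, smoothStep (fun j => a (j + 1)) t) -
      ∫ t in (0 : ℝ)..(x - a 0), smoothStep (fun j => a (j + 1)) t) := by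
  have hmono := (isUnitMonotone_smoothStep fun j => ha (j + 1)).mono
  rw [smoothStep_eq_boxAverage ha, boxAverage_eq_inv_mul_integral (ha 0).ne',
    intervalIntegral.integral_interval_sub_left hmono.intervalIntegrable hmono.intervalIntegrable]

theorem continuous_smoothStep : Continuous (smoothStep a) := by
  have hmono := (isUnitMonotone_smoothStep fun j => ha (j + 1)).mono
  have hc := intervalIntegral.continuous_primitive (fun b c => hmono.intervalIntegrable
    (μ := volume) (a := b) (b := c)) 0
  rw [funext (smoothStep_eq_inv_mul_sub_integral ha)]
  exact continuous_const.mul (hc.sub (hc.comp (continuous_id.sub continuous_const)))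

theorem hasDerivAt_smoothStep (x : ℝ) :
    HasDerivAt (smoothStep a) ((a 0)⁻¹ * (smoothStep (fun j => a (j + 1)) x -
      smoothStep (fun j => a (j + 1)) (x - a 0))) x := by
  have hc := continuous_smoothStep fun j => ha (j + 1)
  have hx := (hc.integral_hasStrictDerivAt 0 x).hasDerivAt
  have hxa := (hc.integral_hasStrictDerivAt 0 (x - a 0)).hasDerivAt.comp_sub_const x (a 0)
  rw [funext (smoothStep_eq_inv_mul_sub_integral ha)]
  exact (hx.sub hxa).const_mul _

theorem deriv_smoothStep :
    deriv (smoothStep a) = (a 0)⁻¹ • ((smoothStep fun j => a (j + 1)) -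
      fun x => smoothStep (fun j => a (j + 1)) (x - a 0)) :=
  funext fun x => (hasDerivAt_smoothStep ha x).deriv

theorem contDiff_smoothStep {n : ℕ∞} : ContDiff ℝ n (smoothStep a) := by
  refine ContDiff.of_le (m := n) (contDiff_infty.2 fun n => ?_) (mod_cast le_top)
  induction n generalizing a with
  | zero => exact contDiff_zero.2 (continuous_smoothStep ha)
  | succ n ih =>
    rw [Nat.cast_add, Nat.cast_one, contDiff_succ_iff_deriv]
    refine ⟨fun x => (hasDerivAt_smoothStep ha x).differentiableAt, by simp, ?_⟩
    have h := ih fun j => ha (j + 1)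
    rw [deriv_smoothStep ha]
    exact contDiff_const.smul (h.sub (h.comp (contDiff_id.sub contDiff_const)))

theorem iteratedDeriv_succ_smoothStep (k : ℕ) :
    iteratedDeriv (k + 1) (smoothStep a) =
      (a 0)⁻¹ • (iteratedDeriv k (smoothStep fun j => a (j + 1)) -
        fun x => iteratedDeriv k (smoothStep fun j => a (j + 1)) (x - a 0)) := by
  have h : ContDiff ℝ k (smoothStep fun j => a (j + 1)) :=
    contDiff_smoothStep (n := k) fun j => ha (j + 1)
  have h' : ContDiff ℝ k fun x => smoothStep (fun j => a (j + 1)) (x - a 0) :=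
    h.comp (contDiff_id.sub contDiff_const)
  rw [iteratedDeriv_succ', deriv_smoothStep ha]
  ext x
  rw [iteratedDeriv_const_smul_field, Pi.smul_apply, Pi.sub_apply,
    iteratedDeriv_sub h.contDiffAt h'.contDiffAt, iteratedDeriv_comp_sub_const]

theorem abs_iteratedDeriv_smoothStep_le (k : ℕ) (x : ℝ) :
    |iteratedDeriv k (smoothStep a) x| ≤ ∏ j ∈ Finset.range k, (2 * (a j)⁻¹) := by
  induction k generalizing a x with
  | zero =>
    have h := isUnitMonotone_smoothStep ha
    simpa [abs_of_nonneg (h.nonneg x)] using h.le_one x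
  | succ k ih =>
    have ih' := ih fun j => ha (j + 1)
    rw [iteratedDeriv_succ_smoothStep ha, Finset.prod_range_succ', Pi.smul_apply, Pi.sub_apply,
      smul_eq_mul, abs_mul, abs_of_pos (inv_pos.2 (ha 0))]
    calc (a 0)⁻¹ * |_| ≤ (a 0)⁻¹ * (_ + _) := mul_le_mul_of_nonneg_left
          ((abs_sub _ _).trans (add_le_add (ih' x) (ih' (x - a 0)))) (inv_pos.2 (ha 0)).le
      _ = _ := by ring

variable {p : ℝ} (hp : 0 < p)
include hp

theorem powIntegral_deriv_smoothStep_le (hs : Summable a) :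
    powIntegral p (deriv (smoothStep a)) ≤ ENNReal.ofReal ((a 0)⁻¹ ^ p * ∑' j, a j) := by
  have ha' : ∀ j, 0 < a (j + 1) := fun j => ha (j + 1)
  have hs' := (summable_nat_add_iff 1).2 hs
  have hsum : ∑' j, a j = a 0 + ∑' j, a (j + 1) := hs.tsum_eq_zero_add
  rw [deriv_smoothStep ha]
  refine (powIntegral_le_of_norm_le_of_Icc (C := (a 0)⁻¹) (a := 0) (b := ∑' j, a j) hp
    (fun x => ?_) fun x hx => ?_).trans_eq (by rw [sub_zero])
  · rw [Pi.smul_apply, norm_smul, Real.norm_of_nonneg (inv_pos.2 (ha 0)).le]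
    exact mul_le_of_le_one_right (inv_pos.2 (ha 0)).le
      ((isUnitMonotone_smoothStep ha').abs_sub_le_one _ _)
  · rw [Pi.smul_apply, Pi.sub_apply]
    rcases lt_or_ge x 0 with h0 | h0
    · rw [smoothStep_of_neg ha' h0, smoothStep_of_neg ha' (by linarith [ha 0]), sub_self, smul_zero]
    · have hx' : ∑' j, a j < x := not_le.1 fun h => hx ⟨h0, h⟩
      rw [smoothStep_of_tsum_le ha' hs' (by linarith [ha 0]),
        smoothStep_of_tsum_le ha' hs' (by linarith), sub_self, smul_zero]

theorem powIntegral_iteratedDeriv_succ_smoothStep_le_mul (hp1 : p ≤ 1) (k : ℕ) :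
    powIntegral p (iteratedDeriv (k + 1) (smoothStep a)) ≤ ENNReal.ofReal (2 * (a 0)⁻¹ ^ p) *
      powIntegral p (iteratedDeriv k (smoothStep fun j => a (j + 1))) := by
  have hm : AEStronglyMeasurable (iteratedDeriv k (smoothStep fun j => a (j + 1))) volume :=
    ((contDiff_smoothStep (n := k) fun j => ha (j + 1)).continuous_iteratedDeriv _
      le_rfl).aestronglyMeasurable
  rw [iteratedDeriv_succ_smoothStep ha, powIntegral_const_smul hp.le]
  refine (mul_le_mul_right (powIntegral_sub_le hp.le hp1 hm _) _).trans_eq ?_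
  rw [powIntegral_comp_sub_right, ← two_mul, ENNReal.ofReal_mul zero_le_two, ENNReal.ofReal_ofNat,
    ← ENNReal.ofReal_rpow_of_pos (inv_pos.2 (ha 0)),
    Real.enorm_of_nonneg (inv_pos.2 (ha 0)).le]
  ring

theorem powIntegral_iteratedDeriv_smoothStep_le (hp1 : p ≤ 1) (hs : Summable a) (k : ℕ) :
    powIntegral p (iteratedDeriv (k + 1) (smoothStep a)) ≤ ENNReal.ofReal
      (2 ^ k * (∏ j ∈ Finset.range (k + 1), (a j)⁻¹ ^ p) * ∑' j, a (j + k)) := by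
  induction k generalizing a with
  | zero => simpa [iteratedDeriv_one] using powIntegral_deriv_smoothStep_le ha hp hs
  | succ k ih =>
    refine (powIntegral_iteratedDeriv_succ_smoothStep_le_mul ha hp hp1 (k + 1)).trans <|
      (mul_le_mul_right (ih (fun j => ha (j + 1)) ((summable_nat_add_iff 1).2 hs)) _).trans_eq ?_
    have := Real.rpow_nonneg (inv_pos.2 (ha 0)).le p
    rw [← ENNReal.ofReal_mul (by positivity), Finset.prod_range_succ' _ (k + 1)]
    simp only [← add_assoc]
    ring_nf

end SmoothStep

/-! ### The choice of the lengths -/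

/-- The average of `D j, D (j + 1), …` with respect to the geometric distribution of parameter `p`.
-/
def geomAverage (p : ℝ) (D : ℕ → ℝ) (j : ℕ) : ℝ := p * ∑' g, (1 - p) ^ g * D (j + g)

section GeomAverage

variable {p : ℝ} {D : ℕ → ℝ} {B : ℝ} (hp0 : 0 < p) (hp1 : p < 1)
include hp0 hp1

theorem mul_tsum_geometric_one_sub (c : ℝ) : p * ∑' g : ℕ, (1 - p) ^ g * c = c := by
  rw [tsum_mul_right, tsum_geometric_of_lt_one (by linarith) (by linarith), sub_sub_cancel,
    mul_inv_cancel_left₀ hp0.ne']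

theorem summable_geometric_one_sub_mul (c : ℝ) : Summable fun g : ℕ => (1 - p) ^ g * c :=
  (summable_geometric_of_lt_one (by linarith) (by linarith)).mul_right c

variable (hD : Monotone D) (hB : ∀ j, D j ≤ B)
include hD hB

theorem summable_geomAverage (j : ℕ) : Summable fun g => (1 - p) ^ g * D (j + g) := by
  have hq0 : 0 ≤ 1 - p := by linarith
  refine .of_norm_bounded (summable_geometric_one_sub_mul hp0 hp1 (|D 0| + |B|)) fun g => ?_
  rw [norm_mul, norm_pow, Real.norm_of_nonneg hq0, Real.norm_eq_abs]
  refine mul_le_mul_of_nonneg_left (abs_le.2 ⟨?_, ?_⟩) (pow_nonneg hq0 g)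
  · linarith [hD (Nat.zero_le (j + g)), neg_abs_le (D 0), abs_nonneg B]
  · linarith [hB (j + g), le_abs_self B, abs_nonneg (D 0)]

theorem geomAverage_eq_add (j : ℕ) :
    geomAverage p D j = p * D j + (1 - p) * geomAverage p D (j + 1) := by
  have hshift : ∀ g, (1 - p) ^ (g + 1) * D (j + (g + 1)) =
      (1 - p) * ((1 - p) ^ g * D (j + 1 + g)) := fun g => by
    rw [pow_succ', mul_assoc, show j + (g + 1) = j + 1 + g by ring]
  unfold geomAverage
  rw [(summable_geomAverage hp0 hp1 hD hB j).tsum_eq_zero_add]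
  simp only [hshift, tsum_mul_left, pow_zero, one_mul, add_zero]
  ring

theorem geomAverage_mono : Monotone (geomAverage p D) := fun i j hij =>
  mul_le_mul_of_nonneg_left ((summable_geomAverage hp0 hp1 hD hB i).tsum_le_tsum
    (fun g => mul_le_mul_of_nonneg_left (hD (by lia)) (pow_nonneg (by linarith) g))
    (summable_geomAverage hp0 hp1 hD hB j)) hp0.le

theorem geomAverage_le (j : ℕ) : geomAverage p D j ≤ B :=
  (mul_le_mul_of_nonneg_left ((summable_geomAverage hp0 hp1 hD hB j).tsum_le_tsum
    (fun g => mul_le_mul_of_nonneg_left (hB (j + g)) (pow_nonneg (by linarith) g))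
    (summable_geometric_one_sub_mul hp0 hp1 B)) hp0.le).trans_eq
    (mul_tsum_geometric_one_sub hp0 hp1 B)

theorem le_geomAverage (j : ℕ) : D j ≤ geomAverage p D j :=
  (mul_tsum_geometric_one_sub hp0 hp1 (D j)).ge.trans <| mul_le_mul_of_nonneg_left
    ((summable_geometric_one_sub_mul hp0 hp1 (D j)).tsum_le_tsum
      (fun g => mul_le_mul_of_nonneg_left (hD (by lia)) (pow_nonneg (by linarith) g))
      (summable_geomAverage hp0 hp1 hD hB j)) hp0.le

theorem geomAverage_zero_eq (N : ℕ) : geomAverage p D 0 =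
    p * ∑ g ∈ Finset.range N, (1 - p) ^ g * D g + (1 - p) ^ N * geomAverage p D N := by
  induction N with
  | zero => simp
  | succ N ih =>
    rw [ih, Finset.sum_range_succ, geomAverage_eq_add hp0 hp1 hD hB N]
    ring

theorem sum_geomAverage (k : ℕ) :
    p * ∑ j ∈ Finset.range k, geomAverage p D j - (1 - p) * geomAverage p D k =
      p * ∑ j ∈ Finset.range k, D j - (1 - p) * geomAverage p D 0 := by
  induction k with
  | zero => simp
  | succ k ih =>
    rw [Finset.sum_range_succ, Finset.sum_range_succ]
    linarith [geomAverage_eq_add hp0 hp1 hD hB k]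

end GeomAverage

theorem sum_pow_mul_sub_succ (q : ℝ) (u : ℕ → ℝ) (N : ℕ) :
    ∑ g ∈ Finset.range N, q ^ g * (u (g + 1) - u g) =
      q ^ N * u N - u 0 + (1 - q) * ∑ g ∈ Finset.range N, q ^ g * u (g + 1) := by
  induction N with
  | zero => simp
  | succ N ih =>
    rw [Finset.sum_range_succ, Finset.sum_range_succ, ih]
    ring

/-- The increments `u 1 - u 0, u 2 - u 1, …`, truncated at the size of `u (N + 1) - u N`. For a
convex sequence they form a bounded monotone sequence. -/
def truncIncrement (u : ℕ → ℝ) (N j : ℕ) : ℝ := min (u (j + 1) - u j) (u (N + 1) - u N)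

theorem sum_truncIncrement_le (u : ℕ → ℝ) (N k : ℕ) :
    ∑ j ∈ Finset.range k, truncIncrement u N j ≤ u k - u 0 :=
  (Finset.sum_le_sum fun _ _ => min_le_left _ _).trans_eq (Finset.sum_range_sub u k)

section Slopes

variable {p : ℝ} {m u : ℕ → ℝ}

theorem monotone_sub_succ (hu : ∀ n, 2 * u (n + 1) ≤ u n + u (n + 2)) :
    Monotone fun n => u (n + 1) - u n :=
  monotone_nat_of_le_succ fun n => by linarith [hu n]

theorem monotone_truncIncrement (hu : ∀ n, 2 * u (n + 1) ≤ u n + u (n + 2)) (N : ℕ) :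
    Monotone (truncIncrement u N) := fun _ _ hij =>
  min_le_min (monotone_sub_succ hu hij) le_rfl

theorem truncIncrement_of_le (hu : ∀ n, 2 * u (n + 1) ≤ u n + u (n + 2)) {N j : ℕ} (hj : j ≤ N) :
    truncIncrement u N j = u (j + 1) - u j :=
  min_eq_left (monotone_sub_succ hu hj)

theorem exists_le_geomAverage_truncIncrement (hp0 : 0 < p) (hp1 : p < 1)
    (hu : ∀ n, 2 * u (n + 1) ≤ u n + u (n + 2)) {C : ℝ} (hC : ∀ n, -C ≤ u n)
    (hdiv : ∀ K, ∃ N, K ≤ ∑ g ∈ Finset.range N, (1 - p) ^ g * u (g + 1)) (K : ℝ) :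
    ∃ N, K ≤ geomAverage p (truncIncrement u N) 0 := by
  have hq0 : 0 < 1 - p := by linarith
  set d := u 1 - u 0 with hd
  obtain ⟨N, hN⟩ := hdiv ((K + |d| + p * |C| + p * u 0) / p ^ 2)
  rw [div_le_iff₀ (by positivity)] at hN
  refine ⟨N, ?_⟩
  have hmono := monotone_truncIncrement hu N
  have hle : ∀ j, truncIncrement u N j ≤ u (N + 1) - u N := fun j => min_le_right _ _
  have hsum : ∑ g ∈ Finset.range N, (1 - p) ^ g * truncIncrement u N g =
      (1 - p) ^ N * u N - u 0 + p * ∑ g ∈ Finset.range N, (1 - p) ^ g * u (g + 1) := by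
    conv_rhs => rw [← sub_sub_cancel 1 p, sub_sub_cancel 1 (1 - p)]
    rw [← sum_pow_mul_sub_succ]
    exact Finset.sum_congr rfl fun g hg => by
      rw [truncIncrement_of_le hu (Finset.mem_range.1 hg).le]
  have hpow1 : (1 - p) ^ N ≤ 1 := pow_le_one₀ hq0.le (by linarith)
  have hu_N : -|C| ≤ (1 - p) ^ N * u N := by
    nlinarith [hC N, le_abs_self C, abs_nonneg C, pow_pos hq0 N]
  have hlast : -|d| ≤ (1 - p) ^ N * geomAverage p (truncIncrement u N) N := by
    have hN0 := hmono (Nat.zero_le N)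
    rw [truncIncrement_of_le hu (Nat.zero_le N), zero_add, ← hd] at hN0
    nlinarith [le_geomAverage hp0 hp1 hmono hle N, neg_abs_le d, abs_nonneg d, pow_pos hq0 N]
  rw [geomAverage_zero_eq hp0 hp1 hmono hle N, hsum]
  nlinarith [mul_le_mul_of_nonneg_left hu_N hp0.le]

theorem exists_le_sum_range_of_exists_le_sum_Icc (hp1 : p < 1)
    (hdiv : ∀ K, ∃ n, K ≤ ∑ j ∈ Finset.Icc 1 n, (1 - p) ^ j * m j) (K : ℝ) :
    ∃ N, K ≤ ∑ g ∈ Finset.range N, (1 - p) ^ g * m (g + 2) := by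
  have hq0 : 0 < 1 - p := by linarith
  obtain ⟨n, hn⟩ := hdiv (max ((1 - p) * m 1 + (1 - p) ^ 2 * K) 1)
  obtain ⟨N, rfl⟩ : ∃ N, n = N + 1 := Nat.exists_eq_succ_of_ne_zero <| by
    rintro rfl
    exact absurd ((le_max_right _ _).trans hn) (by norm_num)
  have hsplit : ∑ j ∈ Finset.Icc 1 (N + 1), (1 - p) ^ j * m j =
      (1 - p) * m 1 + (1 - p) ^ 2 * ∑ g ∈ Finset.range N, (1 - p) ^ g * m (g + 2) := by
    rw [← Finset.Ico_add_one_right_eq_Icc, Finset.sum_Ico_eq_sum_range, Nat.add_sub_cancel,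
      Finset.sum_range_succ', Finset.mul_sum, add_comm]
    simp only [add_zero, pow_one]
    exact congrArg _ (Finset.sum_congr rfl fun g _ => by
      rw [show 1 + (g + 1) = g + 2 by ring, pow_add]; ring)
  rw [hsplit] at hn
  exact ⟨N, le_of_mul_le_mul_left (by linarith [(le_max_left _ _).trans hn]) (pow_pos hq0 2)⟩

theorem exists_slopes (hp0 : 0 < p) (hp1 : p < 1) (hm : ∀ n, 2 * m (n + 1) ≤ m n + m (n + 2))
    {C : ℝ} (hC : ∀ n, -C ≤ m n)
    (hdiv : ∀ K, ∃ n, K ≤ ∑ j ∈ Finset.Icc 1 n, (1 - p) ^ j * m j) (K : ℝ) :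
    ∃ β : ℕ → ℝ, Monotone β ∧ (∃ B, ∀ j, β j ≤ B) ∧ K ≤ β 0 ∧
      ∀ k, p * ∑ j ∈ Finset.range k, β j - (1 - p) * β k ≤ p * m (k + 1) - K := by
  have hq0 : 0 < 1 - p := by linarith
  have hu := fun n => hm (n + 1)
  obtain ⟨N, hN⟩ := exists_le_geomAverage_truncIncrement (u := fun n => m (n + 1)) hp0 hp1 hu
    (fun n => hC (n + 1))
    (exists_le_sum_range_of_exists_le_sum_Icc hp1 hdiv) (max K ((K - p * m 1) / (1 - p)))
  have hmono := monotone_truncIncrement (u := fun n => m (n + 1)) hu N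
  have hle : ∀ j, truncIncrement (fun n => m (n + 1)) N j ≤ m (N + 1 + 1) - m (N + 1) :=
    fun j => min_le_right _ _
  refine ⟨_, geomAverage_mono hp0 hp1 hmono hle, ⟨_, geomAverage_le hp0 hp1 hmono hle⟩,
    (le_max_left _ _).trans hN, fun k => ?_⟩
  have h0 := (le_max_right _ _).trans hN
  rw [div_le_iff₀' hq0] at h0
  have hsum := mul_le_mul_of_nonneg_left (sum_truncIncrement_le (fun n => m (n + 1)) N k) hp0.le
  rw [sum_geomAverage hp0 hp1 hmono hle k]
  linarith

end Slopes

/-- The lengths `exp (-β j) / (j + 1) ^ σ` of the averaging intervals: the slopes `β` are adapted to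
the weights, and the power of `j + 1` makes the tails of the series comparable to their first term.
-/
def boxLength (σ : ℝ) (β : ℕ → ℝ) (j : ℕ) : ℝ := Real.exp (-β j) * ((j : ℝ) + 1) ^ (-σ)

section BoxLength

variable {σ : ℝ} {β : ℕ → ℝ}

theorem boxLength_pos (σ : ℝ) (β : ℕ → ℝ) (j : ℕ) : 0 < boxLength σ β j := by
  unfold boxLength
  positivity

theorem inv_boxLength (σ : ℝ) (β : ℕ → ℝ) (j : ℕ) :
    (boxLength σ β j)⁻¹ = Real.exp (β j + σ * Real.log (j + 1)) := by
  rw [boxLength, Real.rpow_def_of_pos (by positivity), ← Real.exp_add, ← Real.exp_neg]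
  ring_nf

theorem prod_inv_boxLength_rpow (σ : ℝ) (β : ℕ → ℝ) (p : ℝ) (k : ℕ) :
    ∏ j ∈ Finset.range k, (boxLength σ β j)⁻¹ ^ p = Real.exp
      (p * ∑ j ∈ Finset.range k, β j + p * (σ * ∑ j ∈ Finset.range k, Real.log (j + 1))) := by
  simp only [inv_boxLength, ← Real.exp_mul]
  rw [← Real.exp_sum, ← Finset.sum_mul, Finset.sum_add_distrib, ← Finset.mul_sum]
  ring_nf

theorem boxLength_add_le (hσ : 0 ≤ σ) (hβ : Monotone β) (j k : ℕ) :
    boxLength σ β (j + k) ≤ Real.exp (-β k) * ((j : ℝ) + 1) ^ (-σ) := by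
  have hexp : Real.exp (-β (j + k)) ≤ Real.exp (-β k) :=
    Real.exp_le_exp.2 (neg_le_neg (hβ (Nat.le_add_left k j)))
  have hpow : (((j + k : ℕ) : ℝ) + 1) ^ (-σ) ≤ ((j : ℝ) + 1) ^ (-σ) :=
    Real.rpow_le_rpow_of_nonpos (by positivity) (by push_cast; linarith [k.cast_nonneg (α := ℝ)])
      (by linarith)
  exact mul_le_mul hexp hpow (by positivity) (by positivity)

theorem summable_rpow_neg_succ (hσ : 1 < σ) : Summable fun j : ℕ => ((j : ℝ) + 1) ^ (-σ) := by
  refine ((summable_nat_add_iff 1).2 (Real.summable_nat_rpow.2 (neg_lt_neg hσ))).congr fun j => ?_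
  rw [Nat.cast_succ]

theorem summable_boxLength_add (hσ : 1 < σ) (hβ : Monotone β) (k : ℕ) :
    Summable fun j => boxLength σ β (j + k) :=
  .of_nonneg_of_le (fun _ => (boxLength_pos σ β _).le)
    (fun j => boxLength_add_le (by linarith) hβ j k) ((summable_rpow_neg_succ hσ).mul_left _)

theorem tsum_boxLength_add_le (hσ : 1 < σ) (hβ : Monotone β) (k : ℕ) :
    ∑' j, boxLength σ β (j + k) ≤ Real.exp (-β k) * ∑' j : ℕ, ((j : ℝ) + 1) ^ (-σ) := by
  rw [← tsum_mul_left]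
  exact (summable_boxLength_add hσ hβ k).tsum_le_tsum
    (fun j => boxLength_add_le (by linarith) hβ j k) ((summable_rpow_neg_succ hσ).mul_left _)

theorem exists_prod_two_mul_inv_boxLength_le (hσ : 0 ≤ σ) {B : ℝ} (hB : ∀ j, β j ≤ B) :
    ∃ A, ∀ k : ℕ, ∏ j ∈ Finset.range k, (2 * (boxLength σ β j)⁻¹) ≤
      Real.exp (A * (k + 1) ^ 2) := by
  set A := Real.log 2 + |B| + σ with hA
  have hlog2 : 0 ≤ Real.log 2 := Real.log_nonneg one_le_two
  have hA0 : 0 ≤ A := by positivity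
  refine ⟨A, fun k => ?_⟩
  have hfactor : ∀ j ∈ Finset.range k, 2 * (boxLength σ β j)⁻¹ ≤ Real.exp (A * (k + 1)) := by
    intro j hj
    have hjk : (j : ℝ) ≤ k := by exact_mod_cast (Finset.mem_range.1 hj).le
    have hlog : Real.log ((j : ℝ) + 1) ≤ k :=
      (Real.log_le_sub_one_of_pos (by positivity)).trans (by linarith)
    nth_rw 1 [inv_boxLength, ← Real.exp_log two_pos]
    rw [← Real.exp_add, Real.exp_le_exp, hA]
    nlinarith [hB j, le_abs_self B, abs_nonneg B, mul_le_mul_of_nonneg_left hlog hσ,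
      k.cast_nonneg (α := ℝ)]
  refine (Finset.prod_le_prod (fun j _ =>
    mul_nonneg zero_le_two (inv_pos.2 (boxLength_pos σ β j)).le) hfactor).trans ?_
  rw [Finset.prod_const, Finset.card_range, ← Real.exp_nat_mul, Real.exp_le_exp]
  nlinarith [k.cast_nonneg (α := ℝ)]

end BoxLength

theorem exists_mul_log_le {τ : ℝ} (hτ : 0 < τ) (c : ℝ) :
    ∃ C, ∀ n : ℕ, c * n ≤ τ * (n * Real.log (n + 1)) + C := by
  refine ⟨|c| * Real.exp (c / τ), fun n => ?_⟩
  have hn : (0 : ℝ) ≤ n := n.cast_nonneg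
  have hlog : 0 ≤ Real.log ((n : ℝ) + 1) := Real.log_nonneg (by linarith)
  rcases le_total (c / τ) (Real.log (n + 1)) with h | h
  · rw [div_le_iff₀ hτ] at h
    nlinarith [mul_nonneg (abs_nonneg c) (Real.exp_pos (c / τ)).le]
  · have hn_le : (n : ℝ) + 1 ≤ Real.exp (c / τ) := (Real.log_le_iff_le_exp (by linarith)).1 h
    have hcn : c * n ≤ |c| * Real.exp (c / τ) :=
      mul_le_mul (le_abs_self c) (by linarith) hn (abs_nonneg c)
    nlinarith [mul_nonneg hτ.le (mul_nonneg hn hlog)]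

theorem sum_log_succ_le (k : ℕ) :
    ∑ j ∈ Finset.range k, Real.log ((j : ℝ) + 1) ≤ k * Real.log (k + 1) := by
  refine (Finset.sum_le_card_nsmul _ _ (Real.log (k + 1)) fun j hj => ?_).trans_eq (by simp)
  have : (j : ℝ) ≤ k := by exact_mod_cast (Finset.mem_range.1 hj).le
  exact Real.log_le_log (by positivity) (by linarith)

section Lengths

variable {p ρ C : ℝ} {m : ℕ → ℝ}

theorem neg_le_of_mul_log_sub_le (hρ : 0 ≤ ρ)
    (hgrowth : ∀ n : ℕ, ρ * (n * Real.log (n + 1)) - C ≤ m n) (n : ℕ) : -C ≤ m n := by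
  have hn : (0 : ℝ) ≤ n := n.cast_nonneg
  have hlog : 0 ≤ Real.log ((n : ℝ) + 1) := Real.log_nonneg (by linarith)
  linarith [hgrowth n, mul_nonneg hρ (mul_nonneg hn hlog)]

theorem exists_slopes_add_log_le (hp0 : 0 < p) (hp1 : p < 1)
    (hconv : ∀ n, 2 * m (n + 1) ≤ m n + m (n + 2)) (hρ : 1 < ρ)
    (hgrowth : ∀ n : ℕ, ρ * (n * Real.log (n + 1)) - C ≤ m n)
    (hdiv : ∀ K, ∃ n, K ≤ ∑ j ∈ Finset.Icc 1 n, (1 - p) ^ j * m j) :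
    ∃ σ, 1 < σ ∧ ∀ K, ∃ β : ℕ → ℝ, Monotone β ∧ (∃ B, ∀ j, β j ≤ B) ∧ K ≤ β 0 ∧
      ∀ k : ℕ, k * Real.log 2 + (p * ∑ j ∈ Finset.range (k + 1), β j +
        p * (σ * ∑ j ∈ Finset.range (k + 1), Real.log (j + 1))) - β k ≤ p * m (k + 1) - K := by
  -- The weights `η * m` pay for the slopes, and `(1 - η) * m` for the powers of `j + 1` and for the
  -- factor `2 ^ k`: this is possible because `(1 - η) * ρ` is larger than `σ > 1`.
  set σ := (1 + ρ) / 2 with hσ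
  set τ := (ρ - 1) / 4 with hτ
  set η := (ρ - 1) / (4 * ρ) with hη
  have hσ1 : 1 < σ := by linarith
  have hτ0 : 0 < τ := by linarith
  have hη0 : 0 < η := div_pos (by linarith) (by linarith)
  have hηρ : (1 - η) * ρ = σ + τ := by rw [hη, hσ, hτ]; field_simp; ring
  have hη1 : 0 ≤ 1 - η := (pos_of_mul_pos_left (hηρ.symm ▸ add_pos (by linarith) hτ0)
    (by linarith)).le
  obtain ⟨C', hC'⟩ := exists_mul_log_le (mul_pos hp0 hτ0) (Real.log 2)
  refine ⟨σ, hσ1, fun K => ?_⟩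
  obtain ⟨β, hβ, hB, hβ0, hsum⟩ := exists_slopes (m := fun n => η * m n) (C := η * C) hp0 hp1
    (fun n => by nlinarith [hconv n])
    (fun n => by nlinarith [neg_le_of_mul_log_sub_le (by linarith) hgrowth n])
    (fun K => (hdiv (K / η)).imp fun n hn => by
      rw [div_le_iff₀' hη0, Finset.mul_sum] at hn
      exact hn.trans_eq (Finset.sum_congr rfl fun j _ => by ring))
    (K + |p * ((1 - η) * C)| + |C'|)
  have habs := abs_nonneg (p * ((1 - η) * C))
  refine ⟨β, hβ, hB, by linarith [abs_nonneg C'], fun k => ?_⟩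
  have hlog2 := hC' (k + 1)
  have hweight := hgrowth (k + 1)
  have hlogs := sum_log_succ_le (k + 1)
  push_cast at hlog2 hweight hlogs
  set L := ((k : ℝ) + 1) * Real.log (k + 1 + 1)
  have hweight' : p * (σ * L) + p * τ * L - p * ((1 - η) * C) ≤ p * ((1 - η) * m (k + 1)) := by
    rw [show p * (σ * L) + p * τ * L - p * ((1 - η) * C) = p * ((1 - η) * (ρ * L - C)) by
      linear_combination (-(p * L)) * hηρ]
    gcongr
  have hlogs' := mul_le_mul_of_nonneg_left hlogs (show 0 ≤ p * σ by positivity)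
  rw [Finset.sum_range_succ (fun j => β j)]
  linarith [hsum k, le_abs_self (p * ((1 - η) * C)), le_abs_self C', Real.log_nonneg one_le_two]

theorem exists_box_lengths (hp0 : 0 < p) (hp1 : p < 1)
    (hconv : ∀ n, 2 * m (n + 1) ≤ m n + m (n + 2)) (hρ : 1 < ρ)
    (hgrowth : ∀ n : ℕ, ρ * (n * Real.log (n + 1)) - C ≤ m n)
    (hdiv : ∀ K, ∃ n, K ≤ ∑ j ∈ Finset.Icc 1 n, (1 - p) ^ j * m j) (K : ℝ) :
    ∃ a : ℕ → ℝ, (∀ j, 0 < a j) ∧ Summable a ∧ ∑' j, a j ≤ Real.exp (-K) ∧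
      (∀ k, 2 ^ k * (∏ j ∈ Finset.range (k + 1), (a j)⁻¹ ^ p) * ∑' j, a (j + k) ≤
        Real.exp (p * m (k + 1) - K)) ∧
      ∃ A, ∀ k : ℕ, ∏ j ∈ Finset.range k, (2 * (a j)⁻¹) ≤ Real.exp (A * (k + 1) ^ 2) := by
  obtain ⟨σ, hσ, hslopes⟩ := exists_slopes_add_log_le hp0 hp1 hconv hρ hgrowth hdiv
  set Z := ∑' j : ℕ, ((j : ℝ) + 1) ^ (-σ)
  have hZ0 : 0 < Z :=
    (summable_rpow_neg_succ hσ).tsum_pos (fun j => by positivity) 0 (by positivity)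
  obtain ⟨β, hβ, ⟨B, hB⟩, hβ0, hsum⟩ := hslopes (K + Real.log Z)
  have htail : ∀ k, ∑' j, boxLength σ β (j + k) ≤ Real.exp (Real.log Z - β k) := fun k => by
    rw [sub_eq_neg_add, Real.exp_add, Real.exp_log hZ0]
    exact tsum_boxLength_add_le hσ hβ k
  refine ⟨boxLength σ β, boxLength_pos σ β, summable_boxLength_add hσ hβ 0,
    (htail 0).trans (Real.exp_le_exp.2 (by linarith)), fun k => ?_,
    exists_prod_two_mul_inv_boxLength_le (by linarith) hB⟩
  refine (mul_le_mul_of_nonneg_left (htail k) ?_).trans ?_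
  · exact mul_nonneg (by positivity) (Finset.prod_nonneg fun j _ =>
      Real.rpow_nonneg (inv_pos.2 (boxLength_pos σ β j)).le p)
  · rw [prod_inv_boxLength_rpow, ← Real.exp_log (show (0 : ℝ) < 2 ^ k by positivity),
      Real.log_pow, ← Real.exp_add, ← Real.exp_add, Real.exp_le_exp]
    linarith [hsum k]

end Lengths

/-! ### Smooth functions with slowly growing derivatives -/

section SlowDerivs

variable {E : Type*} [NormedAddCommGroup E] [NormedSpace ℝ E]

/-- Smooth functions whose `k`-th derivative is bounded by `exp (A (k + 1) ^ 2)` for some `A`: the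
class from which all approximants are taken. They satisfy the growth condition on
`‖f⁽ⁿ⁾‖_∞` in the definition of the test functions for every `θ ≥ 0`. -/
structure HasSlowDerivs (g : ℝ → E) : Prop where
  contDiff : ContDiff ℝ (⊤ : ℕ∞) g
  exists_norm_le : ∃ A : ℝ, ∀ (k : ℕ) (x : ℝ), ‖iteratedDeriv k g x‖ ≤ Real.exp (A * (k + 1) ^ 2)

theorem continuous_iteratedDeriv_of_contDiff {g : ℝ → E} (hg : ContDiff ℝ (⊤ : ℕ∞) g) (k : ℕ) :
    Continuous (iteratedDeriv k g) :=
  hg.continuous_iteratedDeriv k (mod_cast le_top)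

theorem one_le_natCast_add_one_sq (k : ℕ) : (1 : ℝ) ≤ ((k : ℝ) + 1) ^ 2 :=
  one_le_pow₀ (by linarith [k.cast_nonneg (α := ℝ)])

namespace HasSlowDerivs

variable {f g : ℝ → E} {v : ℝ → ℝ}

theorem contDiffAt (hg : HasSlowDerivs g) (k : ℕ) (x : ℝ) : ContDiffAt ℝ k g x :=
  hg.contDiff.contDiffAt.of_le (mod_cast le_top)

theorem aestronglyMeasurable (hg : HasSlowDerivs g) (k : ℕ) :
    AEStronglyMeasurable (iteratedDeriv k g) :=
  (continuous_iteratedDeriv_of_contDiff hg.contDiff k).aestronglyMeasurable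

theorem zero : HasSlowDerivs (0 : ℝ → E) where
  contDiff := contDiff_const
  exists_norm_le := ⟨0, fun k x => by simp [Pi.zero_def]⟩

theorem iteratedDeriv_add (hf : HasSlowDerivs f) (hg : HasSlowDerivs g) (k : ℕ) :
    iteratedDeriv k (f + g) = iteratedDeriv k f + iteratedDeriv k g :=
  funext fun x => _root_.iteratedDeriv_add (hf.contDiffAt k x) (hg.contDiffAt k x)

theorem add (hf : HasSlowDerivs f) (hg : HasSlowDerivs g) : HasSlowDerivs (f + g) where
  contDiff := hf.contDiff.add hg.contDiff
  exists_norm_le := by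
    obtain ⟨A, hA⟩ := hf.exists_norm_le
    obtain ⟨B, hB⟩ := hg.exists_norm_le
    refine ⟨max A B + Real.log 2, fun k x => ?_⟩
    rw [iteratedDeriv_add hf hg]
    calc ‖iteratedDeriv k f x + iteratedDeriv k g x‖
        ≤ Real.exp (A * (k + 1) ^ 2) + Real.exp (B * (k + 1) ^ 2) :=
          norm_add_le_of_le (hA k x) (hB k x)
      _ ≤ Real.exp (max A B * (k + 1) ^ 2) + Real.exp (max A B * (k + 1) ^ 2) := by
          gcongr
          exacts [le_max_left A B, le_max_right A B]
      _ = Real.exp (max A B * (k + 1) ^ 2 + Real.log 2) := by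
          rw [Real.exp_add, Real.exp_log two_pos, mul_two]
      _ ≤ Real.exp ((max A B + Real.log 2) * (k + 1) ^ 2) := by
          rw [add_mul]
          gcongr
          exact le_mul_of_one_le_right (Real.log_nonneg one_le_two) (one_le_natCast_add_one_sq k)

theorem comp_sub (hg : HasSlowDerivs g) (t : ℝ) : HasSlowDerivs fun x => g (x - t) where
  contDiff := hg.contDiff.comp (contDiff_id.sub contDiff_const)
  exists_norm_le := by
    obtain ⟨A, hA⟩ := hg.exists_norm_le
    refine ⟨A, fun k x => ?_⟩
    rw [iteratedDeriv_comp_sub_const]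
    exact hA k (x - t)

theorem iteratedDeriv_smul_const (hv : HasSlowDerivs v) (c : E) (k : ℕ) :
    iteratedDeriv k (fun x => v x • c) = fun x => iteratedDeriv k v x • c :=
  funext fun x => _root_.iteratedDeriv_smul_const (hv.contDiffAt k x) c

theorem smul_const (hv : HasSlowDerivs v) (c : E) : HasSlowDerivs fun x => v x • c where
  contDiff := hv.contDiff.smul contDiff_const
  exists_norm_le := by
    obtain ⟨A, hA⟩ := hv.exists_norm_le
    refine ⟨A + ‖c‖, fun k x => ?_⟩
    rw [iteratedDeriv_smul_const hv, norm_smul, add_mul, Real.exp_add]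
    gcongr
    · exact hA k x
    · calc ‖c‖ ≤ ‖c‖ * (k + 1) ^ 2 :=
            le_mul_of_one_le_right (norm_nonneg c) (one_le_natCast_add_one_sq k)
        _ ≤ Real.exp (‖c‖ * (k + 1) ^ 2) := by
            linarith [Real.add_one_le_exp (‖c‖ * ((k : ℝ) + 1) ^ 2)]

end HasSlowDerivs

end SlowDerivs

/-! ### Smooth transition functions, plateaus and bumps -/

/-- The monomial `x ^ n / n!`, normalized so that its derivatives are the monomials of lower
degree. -/
def taylorMonomial (n : ℕ) (x : ℝ) : ℝ := x ^ n / n.factorial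

theorem contDiff_taylorMonomial (n : ℕ) {m : ℕ∞} : ContDiff ℝ m (taylorMonomial n) :=
  (contDiff_id.pow n).div_const _

theorem iteratedDeriv_taylorMonomial (n i : ℕ) : iteratedDeriv i (taylorMonomial n) =
    fun x : ℝ => (n.descFactorial i / n.factorial * x ^ (n - i) : ℝ) := by
  ext x
  unfold taylorMonomial
  simp only [div_eq_inv_mul]
  rw [iteratedDeriv_const_mul_field, iteratedDeriv_pow]
  ring

theorem iteratedDeriv_taylorMonomial_of_le {n i : ℕ} (hi : i ≤ n) :
    iteratedDeriv i (taylorMonomial n) = taylorMonomial (n - i) := by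
  ext x
  have hfact : ((n - i).factorial : ℝ) * n.descFactorial i = n.factorial := by
    exact_mod_cast Nat.factorial_mul_descFactorial hi
  have hne : ((n - i).factorial : ℝ) ≠ 0 := by positivity
  have hne' : (n.factorial : ℝ) ≠ 0 := by positivity
  simp only [iteratedDeriv_taylorMonomial, taylorMonomial]
  rw [div_mul_eq_mul_div, div_eq_div_iff hne' hne,
    ← hfact]
  ring

theorem iteratedDeriv_taylorMonomial_of_lt {n i : ℕ} (hi : n < i) :
    iteratedDeriv i (taylorMonomial n) = 0 := by
  ext x
  simp [iteratedDeriv_taylorMonomial, Nat.descFactorial_eq_zero_iff_lt.2 hi]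

theorem abs_taylorMonomial_le_pow (n : ℕ) {x : ℝ} (hx : 0 ≤ x) : |taylorMonomial n x| ≤ x ^ n := by
  rw [taylorMonomial, abs_of_nonneg (by positivity)]
  exact div_le_self (by positivity) (by exact_mod_cast n.factorial_pos)

theorem abs_iteratedDeriv_taylorMonomial_le_one (n i : ℕ) {x : ℝ} (hx : x ∈ Icc (0 : ℝ) 1) :
    |iteratedDeriv i (taylorMonomial n) x| ≤ 1 := by
  rcases le_or_gt i n with hi | hi
  · rw [iteratedDeriv_taylorMonomial_of_le hi]
    exact (abs_taylorMonomial_le_pow _ hx.1).trans (pow_le_one₀ hx.1 hx.2)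
  · simp [iteratedDeriv_taylorMonomial_of_lt hi]

/-- `H` is a smooth monotone transition from `0` on `(-∞, 0)` to `1` on `[r, ∞)`: a smooth
approximation of the Heaviside function. -/
structure IsTransition (H : ℝ → ℝ) (r : ℝ) : Prop extends IsUnitMonotone H where
  contDiff : ContDiff ℝ (⊤ : ℕ∞) H
  eq_zero : ∀ x < 0, H x = 0
  eq_one : ∀ x, r ≤ x → H x = 1

/-- The difference of the transition `H` and its translate by `h`: a smooth approximation of the
indicator function of `[0, h)`. -/
def plateau (H : ℝ → ℝ) (h x : ℝ) : ℝ := H x - H (x - h)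

section Plateau

variable {p : ℝ} {H : ℝ → ℝ} {h r : ℝ}

theorem contDiff_plateau (hH : ContDiff ℝ (⊤ : ℕ∞) H) (h : ℝ) :
    ContDiff ℝ (⊤ : ℕ∞) (plateau H h) :=
  hH.sub (hH.comp (contDiff_id.sub contDiff_const))

theorem iteratedDeriv_plateau (hH : ContDiff ℝ (⊤ : ℕ∞) H) (h : ℝ) (k : ℕ) :
    iteratedDeriv k (plateau H h) = plateau (iteratedDeriv k H) h := by
  have hHk : ContDiff ℝ k H := hH.of_le (mod_cast le_top)
  have hHk' : ContDiff ℝ k fun x => H (x - h) := hHk.comp (contDiff_id.sub contDiff_const)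
  ext x
  unfold plateau
  rw [iteratedDeriv_fun_sub hHk.contDiffAt hHk'.contDiffAt, iteratedDeriv_comp_sub_const]

theorem powIntegral_plateau_le (hp : 0 ≤ p) (hp1 : p ≤ 1) {f : ℝ → ℝ}
    (hf : AEStronglyMeasurable f) (h : ℝ) :
    powIntegral p (plateau f h) ≤ 2 * powIntegral p f := by
  refine (powIntegral_sub_le hp hp1 hf fun x => f (x - h)).trans_eq ?_
  rw [powIntegral_comp_sub_right, two_mul]

namespace IsTransition

theorem of_le (hH : IsTransition H r) {s : ℝ} (hrs : r ≤ s) : IsTransition H s :=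
  { hH with eq_one := fun x hx => hH.eq_one x (hrs.trans hx) }

theorem abs_plateau_le_one (hH : IsTransition H r) (h x : ℝ) : |plateau H h x| ≤ 1 :=
  hH.abs_sub_le_one x (x - h)

theorem iteratedDeriv_plateau_eq_zero (hH : IsTransition H r) (hh : 0 ≤ h) (k : ℕ) {x : ℝ}
    (hx : x ∉ Icc 0 (h + r)) : iteratedDeriv k (plateau H h) x = 0 := by
  have hlocal : plateau H h =ᶠ[𝓝 x] fun _ => (0 : ℝ) := by
    rw [mem_Icc, not_and_or, not_le, not_le] at hx
    rcases hx with hx | hx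
    · filter_upwards [gt_mem_nhds hx] with y hy
      rw [plateau, hH.eq_zero y hy, hH.eq_zero _ (by linarith), sub_zero]
    · filter_upwards [lt_mem_nhds hx] with y hy
      rw [plateau, hH.eq_one y (by linarith), hH.eq_one _ (by linarith), sub_self]
  rw [hlocal.iteratedDeriv_eq]
  simp

theorem powIntegral_sub_indicator_Ici_le (hH : IsTransition H r) (hp : 0 < p) :
    powIntegral p (H - (Ici 0).indicator 1) ≤ ENNReal.ofReal r := by
  refine (powIntegral_le_of_norm_le_of_Icc (C := 1) (a := 0) (b := r) hp (fun x => ?_)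
    fun x hx => ?_).trans_eq (by simp)
  · simp only [Pi.sub_apply, indicator, Pi.one_apply, Real.norm_eq_abs, abs_le]
    split_ifs <;> constructor <;> linarith [hH.nonneg x, hH.le_one x]
  · rcases lt_or_ge x 0 with hx0 | hx0
    · simp [hH.eq_zero x hx0, hx0]
    · simp [hH.eq_one x (by by_contra! hxr; exact hx ⟨hx0, hxr.le⟩), hx0]

theorem plateau_indicator_Ici (hh : 0 ≤ h) :
    plateau ((Ici 0).indicator 1) h = (Ico 0 h).indicator 1 := by
  ext x
  have hiff : x ∈ Ico 0 h ↔ 0 ≤ x ∧ ¬h ≤ x := by rw [mem_Ico, not_le]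
  have himp : h ≤ x → 0 ≤ x := hh.trans
  simp only [plateau, indicator, mem_Ici, hiff, sub_nonneg, Pi.one_apply]
  by_cases hx0 : 0 ≤ x <;> by_cases hxh : h ≤ x <;> simp_all

theorem powIntegral_plateau_sub_indicator_le (hH : IsTransition H r) (hp : 0 < p) (hp1 : p ≤ 1)
    (hh : 0 ≤ h) :
    powIntegral p (plateau H h - (Ico 0 h).indicator 1) ≤ ENNReal.ofReal (2 * r) := by
  have hm : Measurable (H - (Ici 0).indicator 1) :=
    hH.contDiff.continuous.measurable.sub (measurable_one.indicator measurableSet_Ici)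
  have hsplit : plateau H h - (Ico 0 h).indicator 1 = plateau (H - (Ici 0).indicator 1) h := by
    rw [← plateau_indicator_Ici hh]
    ext x
    simp only [plateau, Pi.sub_apply]
    ring
  rw [hsplit, ENNReal.ofReal_mul zero_le_two, ENNReal.ofReal_ofNat]
  refine (powIntegral_plateau_le hp.le hp1 hm.aestronglyMeasurable h).trans ?_
  gcongr
  exact hH.powIntegral_sub_indicator_Ici_le hp

end IsTransition

end Plateau

/-- The monomial `x ^ n / n!` cut off by a plateau over `[0, h]`. Its `n`-th derivative is close to
the indicator function of `[0, h)`. -/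
def monomialBump (H : ℝ → ℝ) (h : ℝ) (n : ℕ) : ℝ → ℝ := taylorMonomial n * plateau H h

/-- The `i`-th term of the Leibniz formula for the `k`-th derivative of `monomialBump H h n`. -/
def leibnizTerm (H : ℝ → ℝ) (h : ℝ) (n k i : ℕ) (x : ℝ) : ℝ :=
  k.choose i * iteratedDeriv i (taylorMonomial n) x * iteratedDeriv (k - i) (plateau H h) x

section Bump

variable {p : ℝ} {H : ℝ → ℝ} {h r : ℝ}

theorem iteratedDeriv_monomialBump (hH : ContDiff ℝ (⊤ : ℕ∞) H) (h : ℝ) (n k : ℕ) :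
    iteratedDeriv k (monomialBump H h n) = ∑ i ∈ Finset.range (k + 1), leibnizTerm H h n k i := by
  have hplateau : ContDiff ℝ k (plateau H h) := (contDiff_plateau hH h).of_le (mod_cast le_top)
  ext x
  rw [Finset.sum_apply, monomialBump,
    iteratedDeriv_mul (contDiff_taylorMonomial n).contDiffAt hplateau.contDiffAt]
  rfl

theorem aestronglyMeasurable_leibnizTerm (hH : ContDiff ℝ (⊤ : ℕ∞) H) (h : ℝ) (n k i : ℕ) :
    AEStronglyMeasurable (leibnizTerm H h n k i) := by
  have hmono : Continuous (iteratedDeriv i (taylorMonomial n)) :=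
    (contDiff_taylorMonomial n (m := i)).continuous_iteratedDeriv i le_rfl
  have hplateau : Continuous (iteratedDeriv (k - i) (plateau H h)) :=
    continuous_iteratedDeriv_of_contDiff (contDiff_plateau hH h) (k - i)
  exact ((continuous_const.mul hmono).mul hplateau).aestronglyMeasurable

theorem leibnizTerm_of_lt {n i : ℕ} (hi : n < i) (k : ℕ) : leibnizTerm H h n k i = 0 := by
  ext x
  simp [leibnizTerm, iteratedDeriv_taylorMonomial_of_lt hi]

theorem leibnizTerm_self (n k : ℕ) :
    leibnizTerm H h n k k = iteratedDeriv k (taylorMonomial n) * plateau H h := by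
  ext x
  simp [leibnizTerm]

namespace IsTransition

theorem abs_leibnizTerm_le (hH : IsTransition H r) (hh : 0 ≤ h) (hr : h + r ≤ 1)
    (n k i : ℕ) (x : ℝ) :
    |leibnizTerm H h n k i x| ≤ k.choose i * |iteratedDeriv (k - i) (plateau H h) x| := by
  rw [leibnizTerm, abs_mul, abs_mul, Nat.abs_cast]
  by_cases hx : x ∈ Icc 0 (h + r)
  · gcongr
    exact mul_le_of_le_one_right (Nat.cast_nonneg _)
      (abs_iteratedDeriv_taylorMonomial_le_one n i ⟨hx.1, hx.2.trans hr⟩)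
  · simp [hH.iteratedDeriv_plateau_eq_zero hh _ hx]

theorem hasSlowDerivs_monomialBump (hH : IsTransition H r) (hslow : HasSlowDerivs H)
    (hh : 0 ≤ h) (hr : h + r ≤ 1) (n : ℕ) : HasSlowDerivs (monomialBump H h n) where
  contDiff := (contDiff_taylorMonomial n).mul (contDiff_plateau hH.contDiff h)
  exists_norm_le := by
    obtain ⟨A, hA⟩ := hslow.exists_norm_le
    have hplateau : ∀ k j x, j ≤ k →
        |iteratedDeriv j (plateau H h) x| ≤ 2 * Real.exp (|A| * (k + 1) ^ 2) := fun k j x hj => by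
      have hHj : ∀ y, |iteratedDeriv j H y| ≤ Real.exp (|A| * (k + 1) ^ 2) := fun y => by
        refine (hA j y).trans ?_
        gcongr
        exact le_abs_self A
      rw [iteratedDeriv_plateau hH.contDiff, two_mul]
      exact (abs_sub _ _).trans (add_le_add (hHj x) (hHj (x - h)))
    refine ⟨|A| + Real.log 2, fun k x => ?_⟩
    rw [iteratedDeriv_monomialBump hH.contDiff, Finset.sum_apply]
    calc ‖∑ i ∈ Finset.range (k + 1), leibnizTerm H h n k i x‖
        ≤ ∑ i ∈ Finset.range (k + 1), k.choose i * (2 * Real.exp (|A| * (k + 1) ^ 2)) := by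
          refine norm_sum_le_of_le _ fun i _ => (hH.abs_leibnizTerm_le hh hr n k i x).trans ?_
          gcongr
          exact hplateau k (k - i) x (k.sub_le i)
      _ = 2 ^ (k + 1) * Real.exp (|A| * (k + 1) ^ 2) := by
          rw [← Finset.sum_mul, ← Nat.cast_sum, Nat.sum_range_choose]
          push_cast
          ring
      _ = Real.exp (|A| * (k + 1) ^ 2 + (k + 1) * Real.log 2) := by
          rw [Real.exp_add, mul_comm, ← Nat.cast_add_one, Real.exp_nat_mul, Real.exp_log two_pos]
      _ ≤ Real.exp ((|A| + Real.log 2) * (k + 1) ^ 2) := by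
          have hk : (k : ℝ) + 1 ≤ (k + 1) ^ 2 := by nlinarith [k.cast_nonneg (α := ℝ)]
          rw [add_mul |A|, mul_comm (Real.log 2)]
          gcongr

theorem powIntegral_leibnizTerm_le (hH : IsTransition H r) (hp : 0 ≤ p) (hp1 : p ≤ 1)
    (hh : 0 ≤ h) (hr : h + r ≤ 1) (n k i : ℕ) :
    powIntegral p (leibnizTerm H h n k i) ≤
      2 * ((k.choose i : ℝ≥0∞) ^ p * powIntegral p (iteratedDeriv (k - i) H)) := by
  have hm : AEStronglyMeasurable (iteratedDeriv (k - i) H) volume :=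
    (continuous_iteratedDeriv_of_contDiff hH.contDiff (k - i)).aestronglyMeasurable
  calc powIntegral p (leibnizTerm H h n k i)
      ≤ powIntegral p ((k.choose i : ℝ) • iteratedDeriv (k - i) (plateau H h)) :=
        powIntegral_mono (f := leibnizTerm H h n k i)
            (g := (k.choose i : ℝ) • iteratedDeriv (k - i) (plateau H h)) hp fun x => by
          rw [Pi.smul_apply, norm_smul, Real.norm_natCast]
          exact hH.abs_leibnizTerm_le hh hr n k i x
    _ = (k.choose i : ℝ≥0∞) ^ p * powIntegral p (plateau (iteratedDeriv (k - i) H) h) := by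
        rw [powIntegral_const_smul hp, iteratedDeriv_plateau hH.contDiff,
          Real.enorm_of_nonneg (Nat.cast_nonneg _), ENNReal.ofReal_natCast]
    _ ≤ (k.choose i : ℝ≥0∞) ^ p * (2 * powIntegral p (iteratedDeriv (k - i) H)) := by
        gcongr
        exact powIntegral_plateau_le hp hp1 hm h
    _ = 2 * ((k.choose i : ℝ≥0∞) ^ p * powIntegral p (iteratedDeriv (k - i) H)) := by ring

theorem powIntegral_leibnizTerm_self_le (hH : IsTransition H r) (hp : 0 < p) (hh : 0 ≤ h)
    (hh2 : 2 * h ≤ 1) (hr : r ≤ h) {n k : ℕ} (hk : k < n) :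
    powIntegral p (leibnizTerm H h n k k) ≤ ENNReal.ofReal ((2 * h) ^ p * (2 * h)) := by
  have hzero : ∀ x ∉ Icc 0 (2 * h), leibnizTerm H h n k k x = 0 := fun x hx => by
    have hx' : x ∉ Icc 0 (h + r) := fun hx' => hx ⟨hx'.1, hx'.2.trans (by linarith)⟩
    rw [leibnizTerm, hH.iteratedDeriv_plateau_eq_zero hh _ hx', mul_zero]
  refine (powIntegral_le_of_norm_le_of_Icc (C := 2 * h) hp (fun x => ?_) hzero).trans_eq
    (by rw [sub_zero])
  by_cases hx : x ∈ Icc 0 (2 * h)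
  · rw [leibnizTerm_self, iteratedDeriv_taylorMonomial_of_le hk.le, Pi.mul_apply, norm_mul]
    calc |taylorMonomial (n - k) x| * |plateau H h x|
        ≤ x ^ (n - k) * 1 := by
          exact mul_le_mul (abs_taylorMonomial_le_pow _ hx.1) (hH.abs_plateau_le_one h x)
            (abs_nonneg _) (pow_nonneg hx.1 _)
      _ ≤ 2 * h := by
          rw [mul_one]
          exact (pow_le_of_le_one hx.1 (hx.2.trans hh2) (by lia)).trans hx.2
  · rw [hzero x hx, norm_zero]
    positivity

theorem powIntegral_leibnizTerm_self_sub_le (hH : IsTransition H r) (hp : 0 < p) (hp1 : p ≤ 1)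
    (hh : 0 ≤ h) (hh2 : 2 * h ≤ 1) (hr : r ≤ h) (n k : ℕ) :
    powIntegral p (leibnizTerm H h n k k - Pi.single (M := fun _ => ℝ → ℝ) n
        ((Ico 0 h).indicator 1) k) ≤
      (if k < n then ENNReal.ofReal ((2 * h) ^ p * (2 * h)) else 0) +
        if k = n then ENNReal.ofReal (2 * r) else 0 := by
  rcases lt_trichotomy k n with hk | rfl | hk
  · simpa [hk, hk.ne] using hH.powIntegral_leibnizTerm_self_le hp hh hh2 hr hk
  · have hself : leibnizTerm H h k k k = plateau H h := by
      rw [leibnizTerm_self, iteratedDeriv_taylorMonomial_of_le le_rfl]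
      ext x
      simp [taylorMonomial]
    simpa [hself] using hH.powIntegral_plateau_sub_indicator_le hp hp1 hh
  · simp [leibnizTerm_of_lt hk, hk.ne', hk.not_gt, powIntegral_zero hp]

theorem powIntegral_sum_leibnizTerm_le (hH : IsTransition H r) (hp : 0 < p) (hp1 : p ≤ 1)
    (hh : 0 ≤ h) (hr : h + r ≤ 1) (n k : ℕ) {B : ℝ≥0∞}
    (hB : ∀ i < k, i ≤ n → (k.choose i : ℝ≥0∞) ^ p * powIntegral p (iteratedDeriv (k - i) H) ≤ B) :
    powIntegral p (∑ i ∈ Finset.range k, leibnizTerm H h n k i) ≤ (n + 1) * (2 * B) := by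
  refine (powIntegral_sum_le hp hp1 _ fun i _ =>
    aestronglyMeasurable_leibnizTerm hH.contDiff h n k i).trans ?_
  have hterm : ∀ i ∈ Finset.range k, powIntegral p (leibnizTerm H h n k i) ≤
      if i < n + 1 then 2 * B else 0 := fun i hi => by
    split_ifs with hin
    · exact (hH.powIntegral_leibnizTerm_le hp.le hp1 hh hr n k i).trans
        (mul_le_mul_right (hB i (Finset.mem_range.1 hi) (Nat.lt_succ_iff.1 hin)) 2)
    · rw [leibnizTerm_of_lt (by lia), powIntegral_zero hp]
  refine (Finset.sum_le_sum hterm).trans ?_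
  have hcard : ((Finset.range k).filter (· < n + 1)).card ≤ n + 1 :=
    (Finset.card_le_card fun i hi =>
      Finset.mem_range.2 (Finset.mem_filter.1 hi).2).trans_eq (Finset.card_range (n + 1))
  rw [← Finset.sum_filter, Finset.sum_const, nsmul_eq_mul]
  gcongr
  exact_mod_cast hcard

end IsTransition

end Bump

/-! ### Regular weight sequences -/

section Growth

variable {p ρ : ℝ} {u : ℕ → ℝ}

theorem eventually_two_mul_log_le_of_liminf_pos (hp0 : 0 < p) (hp1 : p < 1)
    (h : 0 < liminf (fun n : ℕ => (((1 - p) ^ n * u n : ℝ) : EReal)) atTop) :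
    ∀ᶠ n : ℕ in atTop, 2 * (n * Real.log n) ≤ u n := by
  obtain ⟨c, hc0, hc⟩ := EReal.lt_iff_exists_real_btwn.1 h
  have hc0 : 0 < c := by exact_mod_cast hc0
  have hq0 : 0 < 1 - p := by linarith
  have hsmall := (tendsto_pow_const_div_const_pow_of_one_lt 2
    ((one_lt_inv₀ hq0).2 (by linarith))).eventually_lt_const (half_pos hc0)
  filter_upwards [eventually_lt_of_lt_liminf hc, hsmall] with n hlarge hsmall
  have hlarge : c < (1 - p) ^ n * u n := by exact_mod_cast hlarge
  rw [inv_pow, div_inv_eq_mul] at hsmall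
  have hlog : (n : ℝ) * Real.log n ≤ n ^ 2 := by
    rw [pow_two]
    exact mul_le_mul_of_nonneg_left (Real.log_le_self n.cast_nonneg) n.cast_nonneg
  have hq : 0 < (1 - p) ^ n := pow_pos hq0 n
  refine le_of_mul_le_mul_left ?_ hq
  linarith [mul_le_mul_of_nonneg_left hlog hq.le]

theorem exists_lt_succ_of_exists_le_sum (hp0 : 0 < p) (hp1 : p < 1)
    (hdiv : ∀ K, ∃ n, K ≤ ∑ j ∈ Finset.Icc 1 n, (1 - p) ^ j * u j) : ∃ j, u j < u (j + 1) := by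
  by_contra! h
  have hanti : Antitone u := antitone_nat_of_succ_le h
  have hq : ∀ j : ℕ, 0 ≤ (1 - p) ^ j := pow_nonneg (by linarith)
  obtain ⟨n, hn⟩ := hdiv (p⁻¹ * |u 0| + 1)
  have hsum := calc p⁻¹ * |u 0| + 1
      ≤ ∑ j ∈ Finset.Icc 1 n, (1 - p) ^ j * u j := hn
    _ ≤ ∑ j ∈ Finset.Icc 1 n, (1 - p) ^ j * |u 0| := Finset.sum_le_sum fun j _ =>
        mul_le_mul_of_nonneg_left ((hanti j.zero_le).trans (le_abs_self _)) (hq j)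
    _ ≤ ∑' j : ℕ, (1 - p) ^ j * |u 0| := (summable_geometric_one_sub_mul hp0 hp1 _).sum_le_tsum _
        fun j _ => mul_nonneg (hq j) (abs_nonneg _)
    _ = p⁻¹ * |u 0| := by
        rw [eq_inv_mul_iff_mul_eq₀ hp0.ne', mul_tsum_geometric_one_sub hp0 hp1]
  linarith

theorem tendsto_atTop_of_lt_succ (hu : ∀ n, 2 * u (n + 1) ≤ u n + u (n + 2)) {j : ℕ}
    (hj : u j < u (j + 1)) : Tendsto u atTop atTop := by
  rw [← tendsto_add_atTop_iff_nat j]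
  have hlinear : ∀ n : ℕ, u j + n * (u (j + 1) - u j) ≤ u (n + j) := fun n => by
    induction n with
    | zero => simp
    | succ n ih =>
      have hincr : u (j + 1) - u j ≤ u (n + j + 1) - u (n + j) :=
        monotone_sub_succ hu (Nat.le_add_left j n)
      rw [Nat.add_right_comm]
      push_cast
      linarith
  exact tendsto_atTop_mono hlinear (tendsto_atTop_add_const_left _ _
    (tendsto_natCast_atTop_atTop.atTop_mul_const (sub_pos.2 hj)))

theorem mul_log_add_one_le (n : ℕ) : (n : ℝ) * Real.log (n + 1) ≤ n * Real.log n + 1 := by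
  rcases n.eq_zero_or_pos with rfl | hn
  · simp
  · have hn : (0 : ℝ) < n := by exact_mod_cast hn
    have hlog := Real.log_le_sub_one_of_pos (show (0 : ℝ) < (n + 1) / n by positivity)
    rw [Real.log_div (by positivity) hn.ne', add_div, div_self hn.ne', add_sub_cancel_left,
      le_div_iff₀ hn] at hlog
    linarith

theorem exists_mul_log_add_one_sub_le (hρ : 0 ≤ ρ)
    (h : ∀ᶠ n : ℕ in atTop, ρ * (n * Real.log n) ≤ u n) :
    ∃ C, ∀ n : ℕ, ρ * (n * Real.log (n + 1)) - C ≤ u n := by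
  have hbdd : IsBoundedUnder (· ≤ ·) atTop fun n : ℕ => ρ * (n * Real.log (n + 1)) - u n := by
    refine ⟨ρ, eventually_map.2 (h.mono fun n hn => ?_)⟩
    linarith [mul_le_mul_of_nonneg_left (mul_log_add_one_le n) hρ]
  obtain ⟨C, hC⟩ := hbdd.bddAbove_range
  exact ⟨C, fun n => by linarith [hC (mem_range_self n)]⟩

theorem sub_zero_le_mul_sub_succ (hu : ∀ n, 2 * u (n + 1) ≤ u n + u (n + 2)) (k : ℕ) :
    u k - u 0 ≤ k * (u (k + 1) - u k) := by
  rw [← Finset.sum_range_sub]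
  exact (Finset.sum_le_card_nsmul _ _ _ fun j hj =>
    monotone_sub_succ hu (Finset.mem_range.1 hj).le).trans_eq (by simp)

theorem exists_log_sub_le_sub_succ (hu : ∀ n, 2 * u (n + 1) ≤ u n + u (n + 2)) (hρ : 1 ≤ ρ)
    (h : ∀ᶠ n : ℕ in atTop, ρ * (n * Real.log n) ≤ u n) :
    ∃ C, 0 ≤ C ∧ ∀ k : ℕ, Real.log (k + 1) - C ≤ u (k + 1) - u k := by
  obtain ⟨C₀, hC₀⟩ := exists_mul_log_add_one_sub_le (zero_le_one.trans hρ) h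
  refine ⟨|C₀ + u 0| + |u 1 - u 0|, by positivity, fun k => ?_⟩
  rcases k.eq_zero_or_pos with rfl | hk
  · simp only [Nat.cast_zero, zero_add, Real.log_one]
    linarith [neg_abs_le (u 1 - u 0), abs_nonneg (C₀ + u 0)]
  · have hk : (1 : ℝ) ≤ k := by exact_mod_cast hk
    have hlog : 0 ≤ Real.log ((k : ℝ) + 1) := Real.log_nonneg (by linarith)
    refine le_of_mul_le_mul_left ?_ (zero_lt_one.trans_le hk)
    calc (k : ℝ) * (Real.log (k + 1) - (|C₀ + u 0| + |u 1 - u 0|))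
        ≤ k * Real.log (k + 1) - |C₀ + u 0| := by
          nlinarith [abs_nonneg (C₀ + u 0), abs_nonneg (u 1 - u 0)]
      _ ≤ ρ * (k * Real.log (k + 1)) - (C₀ + u 0) := by
          linarith [le_mul_of_one_le_left (show 0 ≤ (k : ℝ) * Real.log (k + 1) by positivity) hρ,
            le_abs_self (C₀ + u 0)]
      _ ≤ u k - u 0 := by linarith [hC₀ k]
      _ ≤ k * (u (k + 1) - u k) := sub_zero_le_mul_sub_succ hu k

theorem exists_le_sum_of_pCharacteristic_eq_top {M : ℕ → ℝ} (h : pCharacteristic p M = ⊤) (K : ℝ) :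
    ∃ n, K ≤ ∑ j ∈ Finset.Icc 1 n, (1 - p) ^ j * Real.log (M j) := by
  by_contra! hlt
  have hle : pCharacteristic p M ≤ (K : EReal) :=
    limsup_le_of_le (h := .of_forall fun n => EReal.coe_le_coe_iff.2 (hlt n).le)
  exact absurd (h ▸ hle) (not_le.2 (EReal.coe_lt_top K))

end Growth

/-- Log-convex weight sequences with infinite `p`-characteristic and
`ρ n log n ≤ log M_n` eventually, for some `ρ > 1`: the growth that both alternatives in
`IsPRegular` force. -/
structure IsWeaklyPRegular (p : ℝ) (M : ℕ → ℝ) : Prop where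
  pos : ∀ n, 0 < M n
  logConvex : ∀ n, 2 * Real.log (M (n + 1)) ≤ Real.log (M n) + Real.log (M (n + 2))
  char_eq_top : pCharacteristic p M = ⊤
  growth : ∃ ρ, 1 < ρ ∧ ∀ᶠ n : ℕ in atTop, ρ * (n * Real.log n) ≤ Real.log (M n)

theorem IsPRegular.isWeaklyPRegular {p : ℝ} {M : ℕ → ℝ} (hM : IsPRegular p M) (hp0 : 0 < p)
    (hp1 : p < 1) : IsWeaklyPRegular p M where
  pos := hM.pos
  logConvex := hM.logConvex
  char_eq_top := hM.char_eq_top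
  growth := by
    rcases hM.regular with hliminf | ⟨-, δ, hδ, e, he, hlog⟩
    · exact ⟨2, one_lt_two, eventually_two_mul_log_le_of_liminf_pos hp0 hp1 hliminf⟩
    · obtain ⟨j, hj⟩ := exists_lt_succ_of_exists_le_sum hp0 hp1
        (exists_le_sum_of_pCharacteristic_eq_top hM.char_eq_top)
      obtain ⟨η, hη, hη1⟩ := exists_between (max_lt hδ one_pos)
      have hη0 : 0 < η := (le_max_right δ 0).trans_lt hη
      refine ⟨η⁻¹, (one_lt_inv₀ hη0).2 hη1, ?_⟩
      filter_upwards [hlog,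
        he.eventually_lt_const (sub_pos.2 ((le_max_left δ 0).trans_lt hη)),
        (tendsto_atTop_of_lt_succ (u := fun n => Real.log (M n)) hM.logConvex
          hj).eventually_ge_atTop 0] with n hn hen hlog0
      rw [inv_mul_le_iff₀ hη0]
      exact hn.trans (mul_le_mul_of_nonneg_right (by linarith) hlog0)

namespace IsWeaklyPRegular

variable {p : ℝ} {M : ℕ → ℝ}

theorem exists_succ_mul_le (hM : IsWeaklyPRegular p M) :
    ∃ c, 1 ≤ c ∧ ∀ k : ℕ, (k + 1) * M k ≤ c * M (k + 1) := by
  obtain ⟨ρ, hρ, hgrowth⟩ := hM.growth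
  obtain ⟨C, hC0, hC⟩ := exists_log_sub_le_sub_succ (u := fun n => Real.log (M n)) hM.logConvex
    hρ.le hgrowth
  refine ⟨Real.exp C, Real.one_le_exp hC0, fun k => ?_⟩
  have hk : (0 : ℝ) < k + 1 := by positivity
  rw [← Real.exp_log hk, ← Real.exp_log (hM.pos k), ← Real.exp_log (hM.pos (k + 1)),
    ← Real.exp_add, ← Real.exp_add, Real.exp_le_exp]
  linarith [hC k]

theorem exists_choose_mul_le (hM : IsWeaklyPRegular p M) :
    ∃ c, 1 ≤ c ∧ ∀ k i : ℕ, i ≤ k → k.choose i * M (k - i) ≤ c ^ i * M k := by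
  obtain ⟨c, hc1, hc⟩ := hM.exists_succ_mul_le
  refine ⟨c, hc1, fun k i => ?_⟩
  induction i with
  | zero => simp
  | succ i ih =>
    intro hik
    obtain ⟨l, rfl⟩ : ∃ l, k = l + 1 + i := ⟨k - (i + 1), by lia⟩
    have ih := ih (by lia)
    have hchoose : ((l + 1 + i).choose (i + 1) : ℝ) * (i + 1) = (l + 1 + i).choose i * (l + 1) := by
      have := Nat.choose_succ_right_eq (l + 1 + i) i
      rw [show l + 1 + i - i = l + 1 by lia] at this
      exact_mod_cast this
    rw [show l + 1 + i - i = l + 1 by lia] at ih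
    rw [show l + 1 + i - (i + 1) = l by lia]
    have hMl := hM.pos l
    calc ((l + 1 + i).choose (i + 1) : ℝ) * M l
        ≤ (l + 1 + i).choose (i + 1) * (i + 1) * M l := by
          gcongr
          exact le_mul_of_one_le_right (by positivity) (by linarith [i.cast_nonneg (α := ℝ)])
      _ = (l + 1 + i).choose i * ((l + 1) * M l) := by rw [hchoose]; ring
      _ ≤ (l + 1 + i).choose i * (c * M (l + 1)) :=
          mul_le_mul_of_nonneg_left (hc l) (Nat.cast_nonneg _)
      _ = c * ((l + 1 + i).choose i * M (l + 1)) := by ring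
      _ ≤ c * (c ^ i * M (l + 1 + i)) := by gcongr
      _ = c ^ (i + 1) * M (l + 1 + i) := by ring

theorem exists_isTransition (hM : IsWeaklyPRegular p M) (hp0 : 0 < p) (hp1 : p < 1) {ε : ℝ}
    (hε : 0 < ε) :
    ∃ H, IsTransition H ε ∧ HasSlowDerivs H ∧
      ∀ k, powIntegral p (iteratedDeriv (k + 1) H) ≤ ENNReal.ofReal (ε * M (k + 1) ^ p) := by
  obtain ⟨ρ, hρ, hgrowth⟩ := hM.growth
  obtain ⟨C, hC⟩ := exists_mul_log_add_one_sub_le (zero_le_one.trans hρ.le) hgrowth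
  obtain ⟨a, ha, hsum, htsum, hbound, A, hA⟩ := exists_box_lengths (m := fun n => Real.log (M n))
    hp0 hp1 hM.logConvex hρ hC (exists_le_sum_of_pCharacteristic_eq_top hM.char_eq_top)
    (-Real.log ε)
  rw [neg_neg, Real.exp_log hε] at htsum
  refine ⟨smoothStep a,
    { toIsUnitMonotone := isUnitMonotone_smoothStep ha
      contDiff := contDiff_smoothStep ha
      eq_zero := fun x hx => smoothStep_of_neg ha hx
      eq_one := fun x hx => smoothStep_of_tsum_le ha hsum (htsum.trans hx) },
    ⟨contDiff_smoothStep ha, A, fun k x => (abs_iteratedDeriv_smoothStep_le ha k x).trans (hA k)⟩,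
    fun k => (powIntegral_iteratedDeriv_smoothStep_le ha hp0 hp1.le hsum k).trans
      (ENNReal.ofReal_le_ofReal ((hbound k).trans_eq ?_))⟩
  rw [sub_neg_eq_add, add_comm, Real.exp_add, Real.exp_log hε, Real.rpow_def_of_pos (hM.pos _),
    mul_comm p]

theorem exists_isTransition_choose_rpow_mul_le (hM : IsWeaklyPRegular p M) (hp0 : 0 < p)
    (hp1 : p < 1) (n : ℕ) {ε r : ℝ} (hε : 0 < ε) (hr : 0 < r) :
    ∃ H, IsTransition H r ∧ HasSlowDerivs H ∧ ∀ k i : ℕ, i < k → i ≤ n →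
      (k.choose i : ℝ≥0∞) ^ p * powIntegral p (iteratedDeriv (k - i) H) ≤
        ENNReal.ofReal (ε * M k ^ p) := by
  obtain ⟨c, hc1, hc⟩ := hM.exists_choose_mul_le
  have hcn : 0 < (c ^ n) ^ p := by positivity
  obtain ⟨H, hH, hslow, hbound⟩ := hM.exists_isTransition hp0 hp1
    (lt_min hr (div_pos hε hcn))
  refine ⟨H, hH.of_le (min_le_left _ _), hslow, fun k i hik hin => ?_⟩
  obtain ⟨l, rfl⟩ : ∃ l, k = l + 1 + i := ⟨k - (i + 1), by lia⟩
  have hMl := (hM.pos (l + 1)).le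
  have hchoose : ((l + 1 + i).choose i : ℝ) * M (l + 1) ≤ c ^ n * M (l + 1 + i) := by
    have hMk := (hM.pos (l + 1 + i)).le
    calc ((l + 1 + i).choose i : ℝ) * M (l + 1) ≤ c ^ i * M (l + 1 + i) := by
          simpa using hc (l + 1 + i) i (by lia)
      _ ≤ c ^ n * M (l + 1 + i) := by gcongr
  rw [Nat.add_sub_cancel]
  calc ((l + 1 + i).choose i : ℝ≥0∞) ^ p * powIntegral p (iteratedDeriv (l + 1) H)
      ≤ ENNReal.ofReal ((l + 1 + i).choose i ^ p) *
          ENNReal.ofReal (ε / (c ^ n) ^ p * M (l + 1) ^ p) := by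
        rw [← ENNReal.ofReal_rpow_of_nonneg (Nat.cast_nonneg _) hp0.le, ENNReal.ofReal_natCast]
        gcongr
        exact (hbound l).trans (by gcongr; exact min_le_right _ _)
    _ = ENNReal.ofReal (ε / (c ^ n) ^ p * ((l + 1 + i).choose i * M (l + 1)) ^ p) := by
        rw [← ENNReal.ofReal_mul (by positivity), Real.mul_rpow (Nat.cast_nonneg _) hMl]
        ring_nf
    _ ≤ ENNReal.ofReal (ε / (c ^ n) ^ p * (c ^ n * M (l + 1 + i)) ^ p) := by gcongr
    _ = ENNReal.ofReal (ε * M (l + 1 + i) ^ p) := by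
        rw [Real.mul_rpow (by positivity) (hM.pos _).le, ← mul_assoc, div_mul_cancel₀ _ hcn.ne']

theorem exists_bump (hM : IsWeaklyPRegular p M) (hp0 : 0 < p) (hp1 : p < 1) (n : ℕ) {h ε : ℝ}
    (hh : 0 < h) (hh2 : 2 * h ≤ 1) (hε : 0 < ε) :
    ∃ v, HasSlowDerivs v ∧ ∀ k, powIntegral p (iteratedDeriv k v -
        Pi.single (M := fun _ => ℝ → ℝ) n ((Ico 0 h).indicator 1) k) ≤
      (if k < n then ENNReal.ofReal ((2 * h) ^ p * (2 * h)) else 0) +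
        ENNReal.ofReal (ε * M k ^ p) := by
  have hMp := fun k => Real.rpow_pos_of_pos (hM.pos k) p
  have hMn := hMp n
  obtain ⟨H, hH, hslow, hchoose⟩ := hM.exists_isTransition_choose_rpow_mul_le hp0 hp1 n
    (ε := ε / (4 * (n + 1))) (r := min h (ε * M n ^ p / 4)) (by positivity) (by positivity)
  have hr : min h (ε * M n ^ p / 4) ≤ h := min_le_left _ _
  refine ⟨monomialBump H h n, hH.hasSlowDerivs_monomialBump hslow hh.le (by linarith) n,
    fun k => ?_⟩
  have hMk := hMp k
  have htop := hH.powIntegral_leibnizTerm_self_sub_le hp0 hp1.le hh.le hh2 hr n k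
  have hlower : powIntegral p (∑ i ∈ Finset.range k, leibnizTerm H h n k i) ≤
      ENNReal.ofReal (ε / 2 * M k ^ p) := by
    refine (hH.powIntegral_sum_leibnizTerm_le hp0 hp1.le hh.le (by linarith) n k
      (hchoose k)).trans_eq ?_
    rw [show (n + 1 : ℝ≥0∞) = ENNReal.ofReal (n + 1) by
        rw [ENNReal.ofReal_add n.cast_nonneg one_pos.le]; simp,
      ← ENNReal.ofReal_ofNat 2, ← ENNReal.ofReal_mul two_pos.le,
      ← ENNReal.ofReal_mul (by positivity)]
    congr 1
    field_simp
    norm_num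
  have hcut : (if k = n then ENNReal.ofReal (2 * min h (ε * M n ^ p / 4)) else 0) ≤
      ENNReal.ofReal (ε / 2 * M k ^ p) := by
    split_ifs with hk
    · subst hk
      exact ENNReal.ofReal_le_ofReal (by linarith [min_le_right h (ε * M k ^ p / 4)])
    · exact zero_le
  rw [iteratedDeriv_monomialBump hH.contDiff, Finset.sum_range_succ, add_sub_assoc]
  refine (powIntegral_add_le hp0.le hp1.le (Finset.aestronglyMeasurable_sum _ fun i _ =>
    aestronglyMeasurable_leibnizTerm hH.contDiff h n k i) _).trans
    ((add_le_add hlower (htop.trans (add_le_add_right hcut _))).trans_eq ?_)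
  rw [add_left_comm, ← ENNReal.ofReal_add (by positivity) (by positivity), ← add_mul,
    add_halves]

end IsWeaklyPRegular

/-! ### Sequences approximated by the derivatives of one function -/

section Jets

variable {E : Type*} [NormedAddCommGroup E] [NormedSpace ℝ E] {p : ℝ} {F G : ℕ → ℝ → E}
  {d e : ℕ → ℝ≥0∞} {M : ℕ → ℝ}

/-- The sequence `F` is within `e` of the jet `(g, g', g'', …)` of a function `g` with slowly
growing derivatives, where `F k` and `g⁽ᵏ⁾` are compared through the integral of `‖·‖ ^ p`. -/
structure HasJetWithin (p : ℝ) (F : ℕ → ℝ → E) (e : ℕ → ℝ≥0∞) : Prop where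
  aestronglyMeasurable : ∀ k, AEStronglyMeasurable (F k)
  exists_powIntegral_le : ∃ g, HasSlowDerivs g ∧ ∀ k, powIntegral p (iteratedDeriv k g - F k) ≤ e k

/-- The sequence `F` is a limit of jets of functions with slowly growing derivatives, for the
quasinorm `sup_k ‖F_k‖_p / M_k`. -/
def IsJetLimit (p : ℝ) (M : ℕ → ℝ) (F : ℕ → ℝ → E) : Prop :=
  ∀ ε : ℝ≥0∞, ε ≠ 0 → HasJetWithin p F fun k => ε * ENNReal.ofReal (M k ^ p)

namespace HasJetWithin

theorem zero (hp : 0 < p) : HasJetWithin p (0 : ℕ → ℝ → E) 0 where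
  aestronglyMeasurable _ := aestronglyMeasurable_zero
  exists_powIntegral_le := ⟨0, .zero, fun k => by
    rw [show iteratedDeriv k (0 : ℝ → E) - (0 : ℕ → ℝ → E) k = 0 by ext x; simp [Pi.zero_def],
      powIntegral_zero hp, Pi.zero_apply]⟩

theorem mono (hF : HasJetWithin p F d) (h : d ≤ e) : HasJetWithin p F e where
  aestronglyMeasurable := hF.aestronglyMeasurable
  exists_powIntegral_le :=
    let ⟨g, hg, hgF⟩ := hF.exists_powIntegral_le
    ⟨g, hg, fun k => (hgF k).trans (h k)⟩

theorem add (hp : 0 ≤ p) (hp1 : p ≤ 1) (hF : HasJetWithin p F d) (hG : HasJetWithin p G e) :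
    HasJetWithin p (F + G) (d + e) where
  aestronglyMeasurable k := (hF.aestronglyMeasurable k).add (hG.aestronglyMeasurable k)
  exists_powIntegral_le := by
    obtain ⟨f, hf, hfF⟩ := hF.exists_powIntegral_le
    obtain ⟨g, hg, hgG⟩ := hG.exists_powIntegral_le
    refine ⟨f + g, hf.add hg, fun k => ?_⟩
    rw [hf.iteratedDeriv_add hg, Pi.add_apply, add_sub_add_comm]
    exact (powIntegral_add_le hp hp1
      ((hf.aestronglyMeasurable k).sub (hF.aestronglyMeasurable k)) _).trans
      (add_le_add (hfF k) (hgG k))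

theorem sum (hp : 0 < p) (hp1 : p ≤ 1) {ι : Type*} (s : Finset ι) {F : ι → ℕ → ℝ → E}
    {e : ι → ℕ → ℝ≥0∞} (h : ∀ i ∈ s, HasJetWithin p (F i) (e i)) :
    HasJetWithin p (∑ i ∈ s, F i) (∑ i ∈ s, e i) := by
  classical
  induction s using Finset.induction_on with
  | empty => exact zero hp
  | insert i s hi ih =>
    rw [Finset.sum_insert hi, Finset.sum_insert hi]
    exact (h i (Finset.mem_insert_self i s)).add hp.le hp1
      (ih fun j hj => h j (Finset.mem_insert_of_mem hj))

theorem of_powIntegral_sub_le (hp : 0 ≤ p) (hp1 : p ≤ 1) (hF : HasJetWithin p F d)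
    (hG : ∀ k, AEStronglyMeasurable (G k)) (h : ∀ k, powIntegral p (F k - G k) ≤ e k) :
    HasJetWithin p G (d + e) where
  aestronglyMeasurable := hG
  exists_powIntegral_le := by
    obtain ⟨g, hg, hgF⟩ := hF.exists_powIntegral_le
    refine ⟨g, hg, fun k => ?_⟩
    rw [← sub_add_sub_cancel _ (F k)]
    exact (powIntegral_add_le hp hp1
      ((hg.aestronglyMeasurable k).sub (hF.aestronglyMeasurable k)) _).trans
      (add_le_add (hgF k) (h k))

theorem comp_sub_smul_const (hp : 0 ≤ p) {F : ℕ → ℝ → ℝ} (hF : HasJetWithin p F e) (t : ℝ)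
    (c : E) : HasJetWithin p (fun k x => F k (x - t) • c) (‖c‖ₑ ^ p • e) where
  aestronglyMeasurable k := ((hF.aestronglyMeasurable k).comp_measurePreserving
    (measurePreserving_sub_right volume t)).smul_const c
  exists_powIntegral_le := by
    obtain ⟨g, hg, hgF⟩ := hF.exists_powIntegral_le
    refine ⟨_, (hg.comp_sub t).smul_const c, fun k => ?_⟩
    have hshift : iteratedDeriv k (fun x => g (x - t) • c) - (fun x => F k (x - t) • c) =
        fun x => (iteratedDeriv k g - F k) (x - t) • c := by
      rw [(hg.comp_sub t).iteratedDeriv_smul_const, iteratedDeriv_comp_sub_const]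
      exact funext fun x => (sub_smul _ _ c).symm
    rw [hshift, powIntegral_smul_const hp, powIntegral_comp_sub_right]
    exact mul_le_mul_right (hgF k) _

end HasJetWithin

namespace IsJetLimit

theorem add (hp : 0 ≤ p) (hp1 : p ≤ 1) (hF : IsJetLimit p M F) (hG : IsJetLimit p M G) :
    IsJetLimit p M (F + G) := fun ε hε =>
  ((hF _ (ENNReal.half_pos hε).ne').add hp hp1 (hG _ (ENNReal.half_pos hε).ne')).mono fun k => by
    rw [Pi.add_apply, ← add_mul, ENNReal.add_halves]

theorem sum (hp : 0 < p) (hp1 : p ≤ 1) {ι : Type*} (s : Finset ι) {F : ι → ℕ → ℝ → E}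
    (h : ∀ i, IsJetLimit p M (F i)) : IsJetLimit p M (∑ i ∈ s, F i) := by
  classical
  induction s using Finset.induction_on with
  | empty => exact fun ε _ => (HasJetWithin.zero hp).mono fun _ => zero_le
  | insert i s hi ih =>
    rw [Finset.sum_insert hi]
    exact (h i).add hp.le hp1 ih

theorem of_forall_exists (hp : 0 ≤ p) (hp1 : p ≤ 1) (hFm : ∀ k, AEStronglyMeasurable (F k))
    (h : ∀ ε : ℝ≥0∞, ε ≠ 0 → ∃ G, IsJetLimit p M G ∧
      ∀ k, powIntegral p (G k - F k) ≤ ε * ENNReal.ofReal (M k ^ p)) : IsJetLimit p M F := by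
  intro ε hε
  have hε2 := (ENNReal.half_pos hε).ne'
  obtain ⟨G, hG, hGF⟩ := h _ hε2
  exact ((hG _ hε2).of_powIntegral_sub_le hp hp1 hFm hGF).mono fun k => by
    rw [Pi.add_apply, ← add_mul, ENNReal.add_halves]

end IsJetLimit

end Jets

section StepFunctions

variable {E : Type*} [NormedAddCommGroup E]

/-- The step function on `N` consecutive intervals of length `ℓ` starting at `a`, with value `c s`
on the `s`-th of them and `0` elsewhere. -/
def stepFunction (a ℓ : ℝ) (N : ℕ) (c : ℕ → E) : ℝ → E :=
  (Ico a (a + N * ℓ)).indicator fun x => c ⌊(x - a) / ℓ⌋₊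

variable {a ℓ : ℝ} {N : ℕ}

theorem sub_mem_Ico_iff (hℓ : 0 < ℓ) {x : ℝ} (s : ℕ) :
    x - (a + s * ℓ) ∈ Ico 0 ℓ ↔ a ≤ x ∧ ⌊(x - a) / ℓ⌋₊ = s := by
  have hgrid : x - (a + s * ℓ) ∈ Ico 0 ℓ ↔ (s : ℝ) ≤ (x - a) / ℓ ∧ (x - a) / ℓ < s + 1 := by
    rw [mem_Ico, le_div_iff₀ hℓ, div_lt_iff₀ hℓ, add_mul, one_mul]
    constructor <;> rintro ⟨h₁, h₂⟩ <;> constructor <;> linarith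
  rw [hgrid]
  constructor
  · rintro h
    have hx := s.cast_nonneg.trans h.1
    rw [le_div_iff₀ hℓ, zero_mul, sub_nonneg] at hx
    exact ⟨hx, (Nat.floor_eq_iff (div_nonneg (sub_nonneg.2 hx) hℓ.le)).2 h⟩
  · rintro ⟨hx, h⟩
    exact (Nat.floor_eq_iff (div_nonneg (sub_nonneg.2 hx) hℓ.le)).1 h

theorem stepFunction_eq_sum [NormedSpace ℝ E] (hℓ : 0 < ℓ) (c : ℕ → E) (x : ℝ) :
    stepFunction a ℓ N c x =
      ∑ s ∈ Finset.range N, (Ico 0 ℓ).indicator (1 : ℝ → ℝ) (x - (a + s * ℓ)) • c s := by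
  have hterm : ∀ s : ℕ, (Ico 0 ℓ).indicator (1 : ℝ → ℝ) (x - (a + s * ℓ)) • c s =
      if ⌊(x - a) / ℓ⌋₊ = s then if a ≤ x then c s else 0 else 0 := fun s => by
    simp only [indicator_apply, sub_mem_Ico_iff hℓ, Pi.one_apply, ite_smul, one_smul, zero_smul]
    grind
  have hmem : x ∈ Ico a (a + N * ℓ) ↔ ⌊(x - a) / ℓ⌋₊ < N ∧ a ≤ x := by
    rw [mem_Ico, and_comm]
    refine and_congr_left fun hx => ?_
    rw [Nat.floor_lt (div_nonneg (sub_nonneg.2 hx) hℓ.le), div_lt_iff₀ hℓ, sub_lt_iff_lt_add']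
  rw [Finset.sum_congr rfl fun s _ => hterm s, Finset.sum_ite_eq]
  simp only [stepFunction, indicator_apply, hmem, Finset.mem_range, ite_and]

theorem powIntegral_stepFunction_sub_le {p η : ℝ} (hp : 0 < p) (hℓ : 0 < ℓ) (hη : 0 ≤ η)
    {f : ℝ → E} (hf : ∀ x ∉ Ico a (a + N * ℓ), f x = 0)
    (hosc : ∀ x y, |x - y| < ℓ → ‖f x - f y‖ ≤ η) :
    powIntegral p (stepFunction a ℓ N (fun s => f (a + s * ℓ)) - f) ≤
      ENNReal.ofReal (η ^ p * (N * ℓ)) := by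
  have hzero : ∀ x ∉ Ico a (a + N * ℓ),
      (stepFunction a ℓ N (fun s => f (a + s * ℓ)) - f) x = 0 := fun x hx => by
    rw [Pi.sub_apply, stepFunction, indicator_of_notMem hx, hf x hx, sub_zero]
  refine (powIntegral_le_of_norm_le_of_Icc hp (C := η) (a := a) (b := a + N * ℓ) (fun x => ?_)
    fun x hx => hzero x fun h => hx (Ico_subset_Icc_self h)).trans_eq (by
      rw [add_sub_cancel_left])
  by_cases hx : x ∈ Ico a (a + N * ℓ)
  · rw [Pi.sub_apply, stepFunction, indicator_of_mem hx]
    have hcell := (sub_mem_Ico_iff hℓ _).2 ⟨hx.1, rfl⟩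
    refine hosc _ _ ?_
    rw [abs_sub_comm, abs_of_nonneg hcell.1]
    exact hcell.2
  · rw [hzero x hx, norm_zero]
    exact hη

end StepFunctions

section Single

variable {E : Type*} [NormedAddCommGroup E] {p : ℝ} {f : ℝ → E}

theorem aestronglyMeasurable_single (hf : AEStronglyMeasurable f) (n k : ℕ) :
    AEStronglyMeasurable (Pi.single (M := fun _ => ℝ → E) n f k) := by
  rcases eq_or_ne k n with rfl | hk
  · rwa [Pi.single_eq_same]
  · rw [Pi.single_eq_of_ne hk]
    exact aestronglyMeasurable_zero

theorem powIntegral_single_sub (hp : 0 < p) (f g : ℝ → E) (n k : ℕ) :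
    powIntegral p (Pi.single (M := fun _ => ℝ → E) n f k - Pi.single (M := fun _ => ℝ → E) n g k) =
      if k = n then powIntegral p (f - g) else 0 := by
  rw [← Pi.sub_apply, ← Pi.single_sub]
  split_ifs with hk
  · rw [hk, Pi.single_eq_same]
  · rw [Pi.single_eq_of_ne hk, powIntegral_zero hp]

theorem eventually_ofReal_mul_rpow_le (hp : 0 < p) (K : ℝ) {δ : ℝ≥0∞} (hδ : δ ≠ 0) :
    ∀ᶠ t : ℝ in 𝓝 0, ENNReal.ofReal (K * t ^ p) ≤ δ := by
  have hcont : ContinuousAt (fun t : ℝ => ENNReal.ofReal (K * t ^ p)) 0 :=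
    ENNReal.continuous_ofReal.continuousAt.comp
      (continuousAt_const.mul (Real.continuousAt_rpow_const _ _ (.inr hp.le)))
  refine hcont.eventually_le_const ?_
  simpa [Real.zero_rpow hp.ne'] using pos_iff_ne_zero.2 hδ

theorem exists_natCast_mul_eq_of_eventually {L : ℝ} (hL : 0 < L) {P : ℝ → Prop}
    (h : ∀ᶠ t in 𝓝 0, P t) : ∃ (N : ℕ) (ℓ : ℝ), 0 < ℓ ∧ N * ℓ = L ∧ P ℓ := by
  obtain ⟨N, hP, hN⟩ := (((tendsto_const_div_atTop_nhds_zero_nat L).eventually h).and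
    (eventually_gt_atTop 0)).exists
  have hN : (0 : ℝ) < N := by exact_mod_cast hN
  exact ⟨N, L / N, div_pos hL hN, by field_simp, hP⟩

theorem exists_eventually_powIntegral_stepFunction_sub_le (hp : 0 < p) (hf : Continuous f)
    (hsupp : HasCompactSupport f) :
    ∃ R : ℝ, 0 < R ∧ ∀ ε : ℝ≥0∞, ε ≠ 0 → ∀ᶠ ℓ : ℝ in 𝓝 0, 0 < ℓ → ∀ {N : ℕ}, N * ℓ = 2 * R →
      powIntegral p (stepFunction (-R) ℓ N (fun s => f (-R + s * ℓ)) - f) ≤ ε := by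
  obtain ⟨R, hR, hzero⟩ := hsupp.exists_pos_le_norm
  refine ⟨R, hR, fun ε hε => ?_⟩
  obtain ⟨η, hηε, hη⟩ := (((eventually_ofReal_mul_rpow_le hp (2 * R) hε).filter_mono
    nhdsWithin_le_nhds).and (self_mem_nhdsWithin (s := Ioi 0))).exists
  obtain ⟨δ, hδ, hosc⟩ := Metric.uniformContinuous_iff.1
    (hsupp.uniformContinuous_of_continuous hf) η hη
  filter_upwards [eventually_lt_nhds hδ] with ℓ hℓδ hℓ N hNℓ
  refine (powIntegral_stepFunction_sub_le hp hℓ (le_of_lt hη) (fun x hx => hzero x ?_)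
    fun x y hxy => ?_).trans ?_
  · rw [mem_Ico, hNℓ, not_and_or, not_le, not_lt] at hx
    rw [Real.norm_eq_abs, le_abs]
    rcases hx with hx | hx
    · right; linarith
    · left; linarith
  · rw [← dist_eq_norm]
    exact (hosc (hxy.trans hℓδ)).le
  · rwa [hNℓ, mul_comm]

end Single

namespace IsWeaklyPRegular

variable {E : Type*} [NormedAddCommGroup E] [NormedSpace ℝ E] {p : ℝ} {M : ℕ → ℝ}

theorem ofReal_rpow_ne_zero (hM : IsWeaklyPRegular p M) (k : ℕ) :
    ENNReal.ofReal (M k ^ p) ≠ 0 :=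
  (ENNReal.ofReal_pos.2 (Real.rpow_pos_of_pos (hM.pos k) p)).ne'

theorem hasJetWithin_single_indicator (hM : IsWeaklyPRegular p M) (hp0 : 0 < p) (hp1 : p < 1)
    (n : ℕ) {ℓ : ℝ} (hℓ : 0 < ℓ) (hℓ2 : 2 * ℓ ≤ 1) {ε : ℝ≥0∞} (hε : ε ≠ 0) :
    HasJetWithin p (Pi.single (M := fun _ => ℝ → ℝ) n ((Ico 0 ℓ).indicator 1))
      fun k => (if k < n then ENNReal.ofReal ((2 * ℓ) ^ p * (2 * ℓ)) else 0) +
        ε * ENNReal.ofReal (M k ^ p) where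
  aestronglyMeasurable :=
    aestronglyMeasurable_single
      ((measurable_one.indicator measurableSet_Ico).aestronglyMeasurable) n
  exists_powIntegral_le := by
    obtain ⟨δ, -, hδ0, hδ⟩ := ENNReal.lt_iff_exists_real_btwn.1 (pos_iff_ne_zero.2 hε)
    rw [ENNReal.ofReal_pos] at hδ0
    obtain ⟨v, hv, hbound⟩ := hM.exists_bump hp0 hp1 n hℓ hℓ2 hδ0
    refine ⟨v, hv, fun k => (hbound k).trans ?_⟩
    rw [ENNReal.ofReal_mul hδ0.le]
    gcongr

theorem hasJetWithin_single_stepFunction (hM : IsWeaklyPRegular p M) (hp0 : 0 < p) (hp1 : p < 1)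
    (n : ℕ) (a : ℝ) {ℓ C : ℝ} (hℓ : 0 < ℓ) (hℓ2 : 2 * ℓ ≤ 1) (N : ℕ) {c : ℕ → E}
    (hc : ∀ s, ‖c s‖ ≤ C) {ε : ℝ≥0∞} (hε : ε ≠ 0) :
    HasJetWithin p (Pi.single (M := fun _ => ℝ → E) n (stepFunction a ℓ N c))
      fun k => (if k < n then ENNReal.ofReal (C ^ p * (2 * (N * ℓ)) * (2 * ℓ) ^ p) else 0) +
        ε * ENNReal.ofReal (M k ^ p) := by
  have hC : 0 ≤ C := (norm_nonneg _).trans (hc 0)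
  set K : ℝ≥0∞ := ENNReal.ofReal (N * C ^ p) with hK
  have hind := hM.hasJetWithin_single_indicator hp0 hp1 n hℓ hℓ2 (ε := ε / (K + 1))
    (ENNReal.div_ne_zero.2 ⟨hε, by finiteness⟩)
  have hsum : Pi.single (M := fun _ => ℝ → E) n (stepFunction a ℓ N c) =
      ∑ s ∈ Finset.range N, (fun k x => Pi.single (M := fun _ => ℝ → ℝ) n
        ((Ico 0 ℓ).indicator 1) k (x - (a + s * ℓ)) • c s : ℕ → ℝ → E) := by
    ext k x
    rcases eq_or_ne k n with rfl | hk
    · simp [stepFunction_eq_sum hℓ]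
    · simp [hk]
  rw [hsum]
  refine (HasJetWithin.sum hp0 hp1.le _ fun (s : ℕ) _ =>
    hind.comp_sub_smul_const hp0.le (a + s * ℓ) (c s)).mono fun k => ?_
  have hcoeff : ∑ s ∈ Finset.range N, ‖c s‖ₑ ^ p ≤ K := by
    refine (Finset.sum_le_card_nsmul _ _ (ENNReal.ofReal (C ^ p)) fun s _ => ?_).trans_eq ?_
    · rw [← ENNReal.ofReal_rpow_of_nonneg hC hp0.le, ← ofReal_norm]
      gcongr
      exact hc s
    · rw [Finset.card_range, nsmul_eq_mul, hK, ENNReal.ofReal_mul N.cast_nonneg,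
        ENNReal.ofReal_natCast]
  have hlower : K * (if k < n then ENNReal.ofReal ((2 * ℓ) ^ p * (2 * ℓ)) else 0) =
      if k < n then ENNReal.ofReal (C ^ p * (2 * (N * ℓ)) * (2 * ℓ) ^ p) else 0 := by
    split_ifs
    · rw [hK, ← ENNReal.ofReal_mul (by positivity)]
      ring_nf
    · exact mul_zero K
  have herror : K * (ε / (K + 1)) ≤ ε :=
    (mul_le_mul_left le_self_add _).trans ENNReal.mul_div_le
  simp only [Finset.sum_apply, Pi.smul_apply, smul_eq_mul, ← Finset.sum_mul]
  refine (mul_le_mul_left hcoeff _).trans ?_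
  rw [mul_add, hlower, ← mul_assoc K]
  exact add_le_add le_rfl (mul_le_mul_left herror _)

theorem isJetLimit_single_of_continuous (hM : IsWeaklyPRegular p M) (hp0 : 0 < p) (hp1 : p < 1)
    (n : ℕ) {f : ℝ → E} (hf : Continuous f) (hsupp : HasCompactSupport f) :
    IsJetLimit p M (Pi.single n f) := by
  intro ε hε
  have hε2 := (ENNReal.half_pos hε).ne'
  have hweight := fun k => mul_ne_zero hε2 (hM.ofReal_rpow_ne_zero k)
  obtain ⟨C, hC⟩ := hsupp.exists_bound_of_continuous hf
  obtain ⟨R, hR, happrox⟩ := exists_eventually_powIntegral_stepFunction_sub_le hp0 hf hsupp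
  have hdouble : Tendsto (fun ℓ : ℝ => 2 * ℓ) (𝓝 0) (𝓝 0) :=
    (continuous_const_mul 2).tendsto' 0 0 (mul_zero 2)
  have hlower := (Finset.eventually_all (Finset.range n)).2 fun k _ => hdouble.eventually
    (eventually_ofReal_mul_rpow_le hp0 (C ^ p * (2 * (2 * R))) (hweight k))
  obtain ⟨N, ℓ, hℓ, hNℓ, hstep, hℓ2, hlower⟩ :=
    exists_natCast_mul_eq_of_eventually (by positivity : 0 < 2 * R)
      ((happrox _ (hweight n)).and ((hdouble.eventually_le_const one_pos).and hlower))
  refine ((hM.hasJetWithin_single_stepFunction hp0 hp1 n (-R) hℓ hℓ2 N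
    (c := fun s => f (-R + s * ℓ)) (fun s => hC _) hε2).of_powIntegral_sub_le hp0.le hp1.le
    (aestronglyMeasurable_single hf.aestronglyMeasurable n)
    fun k => (powIntegral_single_sub hp0 _ f n k).le).mono fun k => ?_
  rw [Pi.add_apply, hNℓ]
  have hhalf : ε * ENNReal.ofReal (M k ^ p) =
      ε / 2 * ENNReal.ofReal (M k ^ p) + ε / 2 * ENNReal.ofReal (M k ^ p) := by
    rw [← add_mul, ENNReal.add_halves]
  rcases lt_trichotomy k n with hk | rfl | hk
  · rw [if_pos hk, if_neg hk.ne, add_zero, hhalf]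
    gcongr
    exact hlower k (Finset.mem_range.2 hk)
  · rw [if_neg (lt_irrefl k), if_pos rfl, zero_add, hhalf]
    gcongr
    exact hstep hℓ hNℓ
  · rw [if_neg hk.not_gt, if_neg hk.ne', zero_add, add_zero, hhalf]
    exact le_add_self

theorem isJetLimit_single (hM : IsWeaklyPRegular p M) (hp0 : 0 < p) (hp1 : p < 1)
    (n : ℕ) {f : ℝ → E} (hf : MemLp f (ENNReal.ofReal p)) :
    IsJetLimit p M (Pi.single n f) := by
  refine .of_forall_exists hp0.le hp1.le (aestronglyMeasurable_single hf.1 n) fun ε hε => ?_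
  set η := ε * ENNReal.ofReal (M n ^ p) with hη
  have hη0 : η ^ p⁻¹ ≠ 0 := by
    simp [ENNReal.rpow_eq_zero_iff, hη, hε, hM.ofReal_rpow_ne_zero n, hp0.le]
  obtain ⟨g, hsupp, hgf, hcont, -⟩ := hf.exists_hasCompactSupport_eLpNorm_sub_le
    ENNReal.ofReal_ne_top hη0
  refine ⟨_, hM.isJetLimit_single_of_continuous hp0 hp1 n hcont hsupp, fun k => ?_⟩
  rw [powIntegral_single_sub hp0]
  split_ifs with hk
  · rw [hk, ← hη, ← eLpNorm_rpow_eq_powIntegral hp0, eLpNorm_sub_comm]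
    exact (ENNReal.rpow_le_rpow hgf hp0.le).trans_eq (ENNReal.rpow_inv_rpow hp0.ne' η)
  · exact zero_le

theorem isJetLimit_of_tendsto (hM : IsWeaklyPRegular p M) (hp0 : 0 < p) (hp1 : p < 1)
    {F : ℕ → ℝ → E} (hF : ∀ n, MemLp (F n) (ENNReal.ofReal p))
    (hlim : Tendsto (fun n => eLpNorm (F n) (ENNReal.ofReal p) / ENNReal.ofReal (M n)) atTop
      (𝓝 0)) :
    IsJetLimit p M F := by
  refine .of_forall_exists hp0.le hp1.le (fun k => (hF k).1) fun ε hε => ?_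
  have hη0 : 0 < ε ^ p⁻¹ := ENNReal.rpow_pos_of_nonneg (pos_iff_ne_zero.2 hε) (inv_nonneg.2 hp0.le)
  obtain ⟨N, hN⟩ := eventually_atTop.1 (hlim.eventually_le_const hη0)
  refine ⟨_, IsJetLimit.sum hp0 hp1.le (Finset.range N) fun n =>
    hM.isJetLimit_single hp0 hp1 n (hF n), fun k => ?_⟩
  rw [Finset.sum_apply, Finset.sum_pi_single]
  split_ifs with hk
  · rw [sub_self, powIntegral_zero hp0]
    exact zero_le
  · have htail := hN k (not_lt.1 fun h => hk (Finset.mem_range.2 h))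
    rw [ENNReal.div_le_iff (ENNReal.ofReal_pos.2 (hM.pos k)).ne' ENNReal.ofReal_ne_top] at htail
    rw [zero_sub, powIntegral_neg, ← eLpNorm_rpow_eq_powIntegral hp0]
    refine (ENNReal.rpow_le_rpow htail hp0.le).trans_eq ?_
    rw [ENNReal.mul_rpow_of_nonneg _ _ hp0.le, ENNReal.rpow_inv_rpow hp0.ne',
      ENNReal.ofReal_rpow_of_nonneg (hM.pos k).le hp0.le]

end IsWeaklyPRegular

/-! ### The image of the canonical map -/

theorem HasSlowDerivs.limsup_log_eLpNorm_le {E : Type*} [NormedAddCommGroup E] [NormedSpace ℝ E]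
    {g : ℝ → E} (hg : HasSlowDerivs g) {q : ℝ} (hq0 : 0 ≤ q) (hq1 : q < 1) :
    limsup (fun n : ℕ => ((q ^ n : ℝ) : EReal) *
      ENNReal.log (eLpNorm (iteratedDeriv n g) ∞ volume)) atTop ≤ 0 := by
  obtain ⟨A, hA⟩ := hg.exists_norm_le
  have hlog : ∀ n : ℕ, ((q ^ n : ℝ) : EReal) *
      ENNReal.log (eLpNorm (iteratedDeriv n g) ∞ volume) ≤
      ((q ^ n * (A * (n + 1) ^ 2) : ℝ) : EReal) := fun n => by
    rw [EReal.coe_mul, eLpNorm_exponent_top]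
    refine mul_le_mul_of_nonneg_left ?_ (by exact_mod_cast pow_nonneg hq0 n)
    refine (ENNReal.log_le_log (eLpNormEssSup_le_of_ae_bound (.of_forall (hA n)))).trans_eq ?_
    rw [ENNReal.log_ofReal, if_neg (not_le.2 (Real.exp_pos _)), Real.log_exp]
  have hlim : Tendsto (fun n : ℕ => q ^ n * (A * ((n : ℝ) + 1) ^ 2)) atTop (𝓝 0) := by
    have hpow := fun i => tendsto_pow_const_mul_const_pow_of_abs_lt_one i
      ((abs_of_nonneg hq0).trans_lt hq1)
    have hsum := (((hpow 2).add ((hpow 1).const_mul 2)).add (hpow 0)).const_mul A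
    simp only [mul_zero, add_zero] at hsum
    exact hsum.congr fun n => by ring
  refine (limsup_le_limsup (.of_forall hlog)).trans_eq ?_
  exact ((continuous_coe_real_ereal.tendsto 0).comp hlim).limsup_eq

theorem iSup_lt_top_of_tendsto_zero {u : ℕ → ℝ≥0∞} (hu : ∀ n, u n < ∞)
    (h : Tendsto u atTop (𝓝 0)) : ⨆ n, u n < ∞ := by
  obtain ⟨N, hN⟩ := eventually_atTop.1 (h.eventually_le_const one_pos)
  refine (iSup_le fun n => ?_).trans_lt (b := 1 + ∑ k ∈ Finset.range N, u k)
    (ENNReal.add_lt_top.2 ⟨ENNReal.one_lt_top, ENNReal.sum_lt_top.2 fun k _ => hu k⟩)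
  rcases lt_or_ge n N with hn | hn
  · exact (Finset.single_le_sum (f := u) (fun _ _ => zero_le) (Finset.mem_range.2 hn)).trans
      le_add_self
  · exact (hN n hn).trans le_self_add

section Image

variable {𝕜 : Type*} [RCLike 𝕜] {p θ : ℝ} {M : ℕ → ℝ}

theorem LpSpace.qnorm_le_mul_qnorm_sub_add (f g : LpSpace 𝕜 p) :
    f.qnorm ≤ ENNReal.LpAddConst (ENNReal.ofReal p) * ((f - g).qnorm + g.qnorm) := by
  simpa only [sub_zero] using (LpSpace.isQuasiDist 𝕜 p).triangle f g 0

theorem carlemanQNorm_le_iff (hM : ∀ n, 0 < M n) {f : ℝ → 𝕜} {a : ℝ≥0∞} :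
    carlemanQNorm p M f ≤ a ↔
      ∀ n, eLpNorm (iteratedDeriv n f) (ENNReal.ofReal p) volume ≤ a * ENNReal.ofReal (M n) :=
  iSup_le_iff.trans <| forall_congr' fun n =>
    ENNReal.div_le_iff (ENNReal.ofReal_pos.2 (hM n)).ne' ENNReal.ofReal_ne_top

theorem mem_ellInftyLp_of_qnorm_le (hM : ∀ n, 0 < M n) {f : ℕ → LpSpace 𝕜 p} {a : ℝ≥0∞}
    (ha : a < ∞) (h : ∀ n, (f n).qnorm ≤ a * ENNReal.ofReal (M n)) : f ∈ ellInftyLp 𝕜 p M :=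
  (iSup_le fun n => (ENNReal.div_le_iff (ENNReal.ofReal_pos.2 (hM n)).ne'
    ENNReal.ofReal_ne_top).2 (h n)).trans_lt ha

theorem mem_cZeroLp_iff_tendsto (hM : ∀ n, 0 < M n) {f : ℕ → LpSpace 𝕜 p} :
    f ∈ cZeroLp 𝕜 p M ↔
      Tendsto (fun n => (f n).qnorm / ENNReal.ofReal (M n)) atTop (𝓝 0) :=
  and_iff_right_of_imp <| iSup_lt_top_of_tendsto_zero fun n =>
    ENNReal.div_lt_top (Lp.eLpNorm_lt_top _).ne (ENNReal.ofReal_pos.2 (hM n)).ne'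

theorem carlemanQNorm_lt_top_of_eLpNorm_sub_le (hM : ∀ n, 0 < M n) {g : ℝ → 𝕜}
    (hg : ∀ n, AEStronglyMeasurable (iteratedDeriv n g)) {f : ℕ → LpSpace 𝕜 p}
    (hf : f ∈ ellInftyLp 𝕜 p M) {a : ℝ≥0∞} (ha : a ≠ ∞)
    (h : ∀ n, eLpNorm (iteratedDeriv n g - ⇑(f n).toLp) (ENNReal.ofReal p) volume ≤
      a * ENNReal.ofReal (M n)) : carlemanQNorm p M g < ∞ := by
  obtain ⟨S, hS, hfS⟩ : ∃ S < ∞, ∀ n, (f n).qnorm ≤ S * ENNReal.ofReal (M n) :=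
    ⟨_, hf, fun n => (ENNReal.div_le_iff (ENNReal.ofReal_pos.2 (hM n)).ne'
      ENNReal.ofReal_ne_top).1 (le_iSup (fun n => (f n).qnorm / ENNReal.ofReal (M n)) n)⟩
  set C := ENNReal.LpAddConst (ENNReal.ofReal p)
  have hC : C < ∞ := ENNReal.LpAddConst_lt_top _
  refine ((carlemanQNorm_le_iff hM).2 fun n => ?_).trans_lt (b := C * (a + S)) (by finiteness)
  have hfm := Lp.aestronglyMeasurable (f n).toLp
  calc eLpNorm (iteratedDeriv n g) (ENNReal.ofReal p) volume
      = eLpNorm (iteratedDeriv n g - ⇑(f n).toLp + ⇑(f n).toLp) (ENNReal.ofReal p) volume := by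
        rw [sub_add_cancel]
    _ ≤ C * (a * ENNReal.ofReal (M n) + S * ENNReal.ofReal (M n)) :=
      (eLpNorm_add_le' ((hg n).sub hfm) hfm _).trans
        (mul_le_mul_right (add_le_add (h n) (hfS n)) _)
    _ = C * (a + S) * ENNReal.ofReal (M n) := by ring

namespace CarlemanTest

theorem qnorm_derivLp (f : CarlemanTest 𝕜 p θ M) (n : ℕ) :
    (derivLp n f).qnorm = eLpNorm (iteratedDeriv n f.1) (ENNReal.ofReal p) volume :=
  eLpNorm_congr_ae (LpSpace.coeFn_ofMemLp (f.memLp n))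

theorem qnorm_derivLp_sub (f : CarlemanTest 𝕜 p θ M) (n : ℕ) (g : LpSpace 𝕜 p) :
    (derivLp n f - g).qnorm =
      eLpNorm (iteratedDeriv n f.1 - ⇑g.toLp) (ENNReal.ofReal p) volume := by
  rw [LpSpace.qnorm_sub]
  exact eLpNorm_congr_ae ((LpSpace.coeFn_ofMemLp (f.memLp n)).sub .rfl)

theorem carlemanQNorm_sub_le_iff (hM : ∀ n, 0 < M n) (f g : CarlemanTest 𝕜 p θ M) {a : ℝ≥0∞} :
    carlemanQNorm p M (f.1 - g.1) ≤ a ↔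
      ∀ n, (derivLp n f - derivLp n g).qnorm ≤ a * ENNReal.ofReal (M n) := by
  rw [carlemanQNorm_le_iff hM]
  refine forall_congr' fun n => ?_
  rw [qnorm_derivLp_sub, CarlemanTest.iteratedDeriv_sub]
  exact iff_of_eq (congrArg (· ≤ _) (eLpNorm_congr_ae
    (EventuallyEq.rfl.sub (LpSpace.coeFn_ofMemLp (g.memLp n)).symm)))

theorem exists_qnorm_derivLp_sub_le (hp0 : 0 < p) (hp1 : p < 1) (hθ : 0 ≤ θ) (hM : ∀ n, 0 < M n)
    {f : ℕ → LpSpace 𝕜 p} (hf : f ∈ ellInftyLp 𝕜 p M)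
    (hjet : IsJetLimit p M fun n => ⇑(f n).toLp) {ε : ℝ≥0∞} (hε0 : ε ≠ 0) (hε : ε ≠ ∞) :
    ∃ g : CarlemanTest 𝕜 p θ M, ∀ n, (derivLp n g - f n).qnorm ≤ ε * ENNReal.ofReal (M n) := by
  obtain ⟨g, hg, hgf⟩ := (hjet (ε ^ p) fun h => hε0 (by simpa [hp0, hp0.not_gt] using h))
    |>.exists_powIntegral_le
  have happrox : ∀ n, eLpNorm (iteratedDeriv n g - ⇑(f n).toLp) (ENNReal.ofReal p) volume ≤
      ε * ENNReal.ofReal (M n) := fun n => by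
    rw [← ENNReal.rpow_le_rpow_iff hp0, eLpNorm_rpow_eq_powIntegral hp0,
      ENNReal.mul_rpow_of_nonneg _ _ hp0.le, ENNReal.ofReal_rpow_of_nonneg (hM n).le hp0.le]
    exact hgf n
  have hfinite : carlemanQNorm p M g < ∞ :=
    carlemanQNorm_lt_top_of_eLpNorm_sub_le hM hg.aestronglyMeasurable hf hε happrox
  exact ⟨⟨g, hg.contDiff, hfinite, (hg.limsup_log_eLpNorm_le (sub_nonneg.2 hp1.le)
    (sub_lt_self 1 hp0)).trans (by exact_mod_cast hθ)⟩, fun n =>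
    (qnorm_derivLp_sub _ n (f n)).trans_le (happrox n)⟩

theorem carlemanQNorm_sub_le_of_qnorm_le (hM : ∀ n, 0 < M n) {f : ℕ → LpSpace 𝕜 p}
    {g h : CarlemanTest 𝕜 p θ M} {a b : ℝ≥0∞}
    (hg : ∀ n, (derivLp n g - f n).qnorm ≤ a * ENNReal.ofReal (M n))
    (hh : ∀ n, (derivLp n h - f n).qnorm ≤ b * ENNReal.ofReal (M n)) :
    carlemanQNorm p M (g.1 - h.1) ≤ ENNReal.LpAddConst (ENNReal.ofReal p) * (a + b) := by
  refine (carlemanQNorm_sub_le_iff hM g h).2 fun n => ?_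
  have hd := LpSpace.isQuasiDist 𝕜 p
  refine (hd.triangle _ (f n) _).trans ?_
  rw [mul_assoc, add_mul, hd.symm (f n)]
  exact mul_le_mul_right (add_le_add (hg n) (hh n)) _

theorem cauchySeq_of_qnorm_le (hM : ∀ n, 0 < M n) {f : ℕ → LpSpace 𝕜 p}
    {g : ℕ → CarlemanTest 𝕜 p θ M} {u : ℕ → ℝ≥0∞} (hu : Tendsto u atTop (𝓝 0))
    (hg : ∀ j n, (derivLp n (g j) - f n).qnorm ≤ u j * ENNReal.ofReal (M n)) : CauchySeq g := by
  rw [cauchySeq_iff_tendsto, (CarlemanTest.hasBasis_uniformity 𝕜 p θ M).tendsto_right_iff,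
    ← prod_atTop_atTop_eq]
  intro ε hε
  have hpair : Tendsto (fun i : ℕ × ℕ => ENNReal.LpAddConst (ENNReal.ofReal p) * (u i.1 + u i.2))
      (atTop ×ˢ atTop) (𝓝 0) := by
    have := ENNReal.Tendsto.const_mul (a := ENNReal.LpAddConst (ENNReal.ofReal p))
      ((hu.comp tendsto_fst).add (hu.comp tendsto_snd)) (.inr (ENNReal.LpAddConst_lt_top _).ne)
    rwa [add_zero, mul_zero] at this
  filter_upwards [hpair.eventually_lt_const hε] with i hi
  exact (carlemanQNorm_sub_le_of_qnorm_le hM (hg i.1) (hg i.2)).trans_lt hi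

theorem tendsto_derivLp_of_qnorm_le {f : ℕ → LpSpace 𝕜 p} {g : ℕ → CarlemanTest 𝕜 p θ M}
    {u : ℕ → ℝ≥0∞} (hu : Tendsto u atTop (𝓝 0)) (n : ℕ)
    (hg : ∀ j, (derivLp n (g j) - f n).qnorm ≤ u j * ENNReal.ofReal (M n)) :
    Tendsto (fun j => derivLp n (g j)) atTop (𝓝 (f n)) := by
  rw [(nhds_basis_uniformity (LpSpace.hasBasis_uniformity 𝕜 p)).tendsto_right_iff]
  intro ε hε
  have hbound := ENNReal.Tendsto.mul_const (b := ENNReal.ofReal (M n)) hu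
    (.inr ENNReal.ofReal_ne_top)
  rw [zero_mul] at hbound
  filter_upwards [hbound.eventually_lt_const hε] with j hj
  exact (hg j).trans_lt hj

end CarlemanTest

theorem tendsto_derivLp_comap_nhds (hp0 : 0 < p) (hp1 : p ≤ 1) (F : CarlemanSpace 𝕜 p θ M)
    (n : ℕ) : Tendsto (CarlemanTest.derivLp n)
      (comap ((↑) : CarlemanTest 𝕜 p θ M → CarlemanSpace 𝕜 p θ M) (𝓝 F))
      (𝓝 (carlemanPi F n)) :=
  (((continuous_carlemanPi hp0 hp1 n).tendsto F).comp tendsto_comap).congr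
    fun f => carlemanPi_coe hp0 f n

theorem exists_carlemanPi_eq_of_isJetLimit (hp0 : 0 < p) (hp1 : p < 1) (hθ : 0 ≤ θ)
    (hM : ∀ n, 0 < M n) {f : ℕ → LpSpace 𝕜 p} (hf : f ∈ ellInftyLp 𝕜 p M)
    (hjet : IsJetLimit p M fun n => ⇑(f n).toLp) :
    ∃ F : CarlemanSpace 𝕜 p θ M, carlemanPi F = f := by
  have := LpSpace.t0Space (𝕜 := 𝕜) hp0
  choose g hg using fun j : ℕ => CarlemanTest.exists_qnorm_derivLp_sub_le (θ := θ) hp0 hp1 hθ hM hf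
    hjet (ε := ((j : ℝ≥0∞) + 1)⁻¹) (ENNReal.inv_ne_zero.2 (by finiteness))
    (by simp)
  have hu : Tendsto (fun j : ℕ => ((j : ℝ≥0∞) + 1)⁻¹) atTop (𝓝 0) := by
    exact_mod_cast (tendsto_add_atTop_iff_nat 1).2 ENNReal.tendsto_inv_nat_nhds_zero
  obtain ⟨F, hF⟩ := cauchySeq_tendsto_of_complete
    ((UniformSpace.Completion.uniformContinuous_coe (CarlemanTest 𝕜 p θ M)).comp_cauchySeq
      (CarlemanTest.cauchySeq_of_qnorm_le hM hu hg))
  exact ⟨F, funext fun n => tendsto_nhds_unique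
    ((tendsto_derivLp_comap_nhds hp0 hp1.le F n).comp (tendsto_comap_iff.2 hF))
    (CarlemanTest.tendsto_derivLp_of_qnorm_le hu n fun j => hg j n)⟩

theorem exists_forall_qnorm_derivLp_sub_carlemanPi_le (hp0 : 0 < p) (hp1 : p ≤ 1)
    (hM : ∀ n, 0 < M n) (F : CarlemanSpace 𝕜 p θ M) :
    ∃ g : CarlemanTest 𝕜 p θ M, ∀ n, (carlemanPi F n - CarlemanTest.derivLp n g).qnorm ≤
      ENNReal.LpAddConst (ENNReal.ofReal p) * 2 * ENNReal.ofReal (M n) := by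
  have hne := UniformSpace.Completion.isDenseInducing_coe.comap_nhds_neBot F
  have hcau : Cauchy (comap ((↑) : CarlemanTest 𝕜 p θ M → CarlemanSpace 𝕜 p θ M) (𝓝 F)) :=
    cauchy_nhds.comap (UniformSpace.Completion.isUniformInducing_coe _).comap_uniformity.le
  obtain ⟨t, ht, hdiam⟩ := (cauchy_iff.1 hcau).2 _
    ((CarlemanTest.hasBasis_uniformity 𝕜 p θ M).mem_of_mem (zero_lt_one (α := ℝ≥0∞)))
  obtain ⟨g, hgt⟩ := Filter.nonempty_of_mem ht
  refine ⟨g, fun n => ?_⟩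
  obtain ⟨f, hft, hf⟩ := ((eventually_mem_set.2 ht).and
    ((nhds_basis_uniformity (LpSpace.hasBasis_uniformity 𝕜 p)).tendsto_right_iff.1
      (tendsto_derivLp_comap_nhds hp0 hp1 F n) _ (ENNReal.ofReal_pos.2 (hM n)))).exists
  have hFf : (CarlemanTest.derivLp n f - carlemanPi F n).qnorm < ENNReal.ofReal (M n) := hf
  have hfg := hdiam (mk_mem_prod hft hgt)
  rw [mem_ofPred_eq] at hfg
  have hfg_n := (CarlemanTest.carlemanQNorm_sub_le_iff hM f g).1 hfg.le n
  have hd := LpSpace.isQuasiDist 𝕜 p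
  calc (carlemanPi F n - CarlemanTest.derivLp n g).qnorm
      ≤ ENNReal.LpAddConst (ENNReal.ofReal p) * ((carlemanPi F n - CarlemanTest.derivLp n f).qnorm +
          (CarlemanTest.derivLp n f - CarlemanTest.derivLp n g).qnorm) := hd.triangle _ _ _
    _ ≤ ENNReal.LpAddConst (ENNReal.ofReal p) *
          (ENNReal.ofReal (M n) + 1 * ENNReal.ofReal (M n)) :=
      mul_le_mul_right (add_le_add ((hd.symm _ _).trans_le hFf.le) hfg_n) _
    _ = ENNReal.LpAddConst (ENNReal.ofReal p) * 2 * ENNReal.ofReal (M n) := by ring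

theorem carlemanPi_mem_ellInftyLp (hp0 : 0 < p) (hp1 : p ≤ 1) (hM : ∀ n, 0 < M n)
    (F : CarlemanSpace 𝕜 p θ M) : carlemanPi F ∈ ellInftyLp 𝕜 p M := by
  obtain ⟨g, hg⟩ := exists_forall_qnorm_derivLp_sub_carlemanPi_le hp0 hp1 hM F
  set C := ENNReal.LpAddConst (ENNReal.ofReal p)
  have hC : C ≠ ∞ := (ENNReal.LpAddConst_lt_top _).ne
  have hgfinite : carlemanQNorm p M g.1 ≠ ∞ := g.2.2.1.ne
  refine mem_ellInftyLp_of_qnorm_le hM (a := C * (C * 2 + carlemanQNorm p M g.1)) (by finiteness)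
    fun n => ?_
  have hgn := (g.qnorm_derivLp n).trans_le ((carlemanQNorm_le_iff hM).1 le_rfl n)
  rw [mul_assoc C, add_mul]
  exact (LpSpace.qnorm_le_mul_qnorm_sub_add _ (CarlemanTest.derivLp n g)).trans
    (mul_le_mul_right (add_le_add (hg n) hgn) C)

end Image

end

theorem mainTheorem5_general (𝕜 : Type*) [RCLike 𝕜] (p θ : ℝ) (hp0 : 0 < p) (hp1 : p < 1)
    (hθ : 0 ≤ θ) (M : ℕ → ℝ) (hM : IsWeaklyPRegular p M) :
    cZeroLp 𝕜 p M ⊆ Set.range (carlemanPi : CarlemanSpace 𝕜 p θ M → ℕ → LpSpace 𝕜 p) ∧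
    Set.range (carlemanPi : CarlemanSpace 𝕜 p θ M → ℕ → LpSpace 𝕜 p) ⊆ ellInftyLp 𝕜 p M ∧
    ∀ f : ℕ → LpSpace 𝕜 p,
      Tendsto (fun n => (f n).qnorm / ENNReal.ofReal (M n)) atTop (𝓝 0) →
        ∃ F : CarlemanSpace 𝕜 p θ M, ∀ n, carlemanPi F n = f n := by
  have hsurj : ∀ f ∈ cZeroLp 𝕜 p M, ∃ F : CarlemanSpace 𝕜 p θ M, carlemanPi F = f :=
    fun f hf => exists_carlemanPi_eq_of_isJetLimit hp0 hp1 hθ hM.pos hf.1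
      (hM.isJetLimit_of_tendsto hp0 hp1 (fun n => Lp.memLp (f n).toLp) hf.2)
  refine ⟨hsurj, ?_, fun f hf => ?_⟩
  · rintro _ ⟨F, rfl⟩
    exact carlemanPi_mem_ellInftyLp hp0 hp1.le hM.pos F
  · obtain ⟨F, hF⟩ := hsurj f ((mem_cZeroLp_iff_tendsto hM.pos).2 hf)
    exact ⟨F, congrFun hF⟩

theorem mainTheorem5 (𝕜 : Type*) [RCLike 𝕜] (p θ : ℝ) (hp0 : 0 < p) (hp1 : p < 1) (hθ : 0 ≤ θ)
    (M : ℕ → ℝ) (hM : IsPRegular p M) :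
    cZeroLp 𝕜 p M ⊆ Set.range (carlemanPi : CarlemanSpace 𝕜 p θ M → ℕ → LpSpace 𝕜 p) ∧
    Set.range (carlemanPi : CarlemanSpace 𝕜 p θ M → ℕ → LpSpace 𝕜 p) ⊆ ellInftyLp 𝕜 p M ∧
    ∀ f : ℕ → LpSpace 𝕜 p,
      Tendsto (fun n => (f n).qnorm / ENNReal.ofReal (M n)) atTop (𝓝 0) →
        ∃ F : CarlemanSpace 𝕜 p θ M, ∀ n, carlemanPi F n = f n :=
  mainTheorem5_general 𝕜 p θ hp0 hp1 hθ M (hM.isWeaklyPRegular hp0 hp1)
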